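/- Let $w=(w(t))_{t\in[0,1]}$ be a standard $d$-dimensional Brownian motion on a probability space $(\Omega,\mathcal F,\mathbb P)$. For a symmetric square integrable kernel $f$ of order $k$ on $([0,1]\times\{1,\dots,d\})^k$ let $I_k(f)\in L^2(\mathbb P)$ be its $k$-fold multiple Itô integral with respect to $w$ (the linear and $L^2$-continuous extension of $\mathbf 1_{A_1\times\cdots\times A_k}\mapsto\prod_{l}\big(w_{i_l}(t_l)-w_{i_l}(s_l)\big)$ for pairwise disjoint cells $A_l=(s_l,t_l]\times\{i_l\}$; $I_0(c)=c$). For $\gamma\in\mathbb R$ let $\mathbb D^{2,\gamma}$ be the completion of the space of finite sums $\sum_k I_k(f_k)$ for the norm $$\Big\|\sum_k I_k(f_k)\Big\|_{2,\gamma}^2=\sum_k (k+1)^\gamma\,\mathbb E\big[I_k(f_k)^2\big],$$ i.e. the space of formal series $\sum_{k\ge 0}I_k(f_k)$ with symmetric kernels for which this quantity is finite. For a linear subspace $H\subset L^2([0,1],\mathbb R^d)$ put $$\sigma(H)=\sigma\Big(\int_0^1 h(t)\cdot dw(t)=\sum_{i=1}^d\int_0^1 h_i(t)\,dw_i(t)\;:\;h\in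 H\Big).$$ An element $\eta\in\mathbb D^{2,\gamma}$, $\gamma<0$, is called $\sigma(H)$-measurable if it is a limit in $\mathbb D^{2,\gamma}$ of square integrable random variables (identified with their Itô–Wiener expansions) that are almost surely equal to $\sigma(H)$-measurable ones. The Wick product of $\eta_1=\sum_k I_k(f_k)$ and $\eta_2=\sum_k I_k(g_k)$ is the formal series $$:\eta_1\eta_2:\;=\sum_{n\ge 0} I_n\Big(\sum_{i+j=n} f_i\,\widehat\otimes\, g_j\Big),$$ where $\widehat\otimes$ is the symmetrised tensor product. **Proposition.** Let $H_1,H_2$ be orthogonal linear subspaces of $L^2([0,1],\mathbb R^d)$, let $\gamma_1,\gamma_2<0$, and let $\eta_j\in\mathbb D^{2,\gamma_j}$ be $\sigma(H_j)$-measurable, $j=1,2$. Then the Wick product $:\eta_1\eta_2:$ is well defined, belongs to $\mathbb D^{2,\gamma_1+\gamma_2}$, and $$\big\|:\eta_1\eta_2:\big\|_{2,\gamma_1+\gamma_2}\le\|\eta_1\|_{2,\gamma_1}\,\|\eta_2\|_{2,\gamma_2}.$$ -/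

import Mathlib

open MeasureTheory ProbabilityTheory

namespace WickSobolev

/-! ### Brownian motion on `[0,1]` and the Wiener integral -/

/-- Standard `d`-dimensional Brownian motion indexed by `[0,1]`: it starts at `0`, has independent
increments, `w t - w s` has law `N(0, (t - s) Id)` for `s ≤ t`, and has continuous paths a.s. -/
structure IsBrownianMotion {Ω : Type*} [MeasurableSpace Ω] {d : ℕ}
    (w : unitInterval → Ω → EuclideanSpace ℝ (Fin d)) (P : Measure Ω) : Prop where
  start : ∀ᵐ ω ∂P, w 0 ω = 0
  indep : HasIndepIncrements w P
  law : ∀ s t : unitInterval, s ≤ t → HasLaw (fun ω => w t ω - w s ω)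
    ((stdGaussian (EuclideanSpace ℝ (Fin d))).map (fun x => √((t : ℝ) - s) • x)) P
  cont : ∀ᵐ ω ∂P, Continuous (fun t => w t ω)

/-- The Hilbert space `L²([0,1], ℝ^d)`. -/
abbrev NoiseSpace (d : ℕ) : Type :=
  Lp (EuclideanSpace ℝ (Fin d)) 2 (volume : Measure unitInterval)

section

variable {Ω : Type*} [MeasurableSpace Ω] {d : ℕ}

/-- The graph of the Wiener integral on step functions is spanned by the pairs
`(1_{(s,t]} e_i, w_i(t) - w_i(s))`, and the Wiener integral is its closure in `L² × L²`:
`(h, X) ∈ wienerGraph w P` means `X = ∑ i, ∫₀¹ h_i(t) dw_i(t)`. -/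
noncomputable def wienerGraph (w : unitInterval → Ω → EuclideanSpace ℝ (Fin d)) (P : Measure Ω) :
    Submodule ℝ (NoiseSpace d × Lp ℝ 2 P) :=
  (Submodule.span ℝ {p | ∃ (s t : unitInterval) (i : Fin d), s ≤ t ∧
    p.1 =ᵐ[volume] (Set.Ioc s t).indicator (fun _ => EuclideanSpace.single i (1 : ℝ)) ∧
    p.2 =ᵐ[P] fun ω => w t ω i - w s ω i}).topologicalClosure

/-- `X` is the Wiener integral `∫₀¹ h(t) · dw(t)`. -/
def IsWienerIntegral (w : unitInterval → Ω → EuclideanSpace ℝ (Fin d)) (P : Measure Ω)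
    (h : NoiseSpace d) (X : Lp ℝ 2 P) : Prop :=
  (h, X) ∈ wienerGraph w P

/-- The `σ`-field generated by the Wiener integrals of the elements of `H`. -/
@[reducible]
noncomputable def noiseSigma (w : unitInterval → Ω → EuclideanSpace ℝ (Fin d)) (P : Measure Ω)
    (H : Submodule ℝ (NoiseSpace d)) : MeasurableSpace Ω :=
  ⨆ X ∈ {X : Lp ℝ 2 P | ∃ h ∈ H, IsWienerIntegral w P h X},
    MeasurableSpace.comap (fun ω => X ω) (borel ℝ)

/-! ### Multiple Itô integrals -/

/-- The measure on `([0,1] × {1,…,d})^k` for which kernels are square integrable. -/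
noncomputable def kernelMeasure (d k : ℕ) : Measure (Fin k → unitInterval × Fin d) :=
  Measure.pi fun _ => (volume : Measure unitInterval).prod Measure.count

instance (d k : ℕ) : SigmaFinite (kernelMeasure d k) := by
  unfold kernelMeasure; infer_instance

/-- Square integrable kernels of order `k`; the value at `((t₁,i₁),…,(t_k,i_k))` is
`f^{i₁…i_k}(t₁,…,t_k)`. -/
abbrev Kernel (d k : ℕ) : Type := Lp ℝ 2 (kernelMeasure d k)

theorem measurePreserving_perm (d k : ℕ) (σ : Equiv.Perm (Fin k)) :
    MeasurePreserving (fun x : Fin k → unitInterval × Fin d => x ∘ σ)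
      (kernelMeasure d k) (kernelMeasure d k) := by
  have h := measurePreserving_piCongrLeft
    (fun _ : Fin k => (volume : Measure unitInterval).prod (Measure.count : Measure (Fin d))) σ.symm
  have e : (fun x : Fin k → unitInterval × Fin d => x ∘ σ) =
      MeasurableEquiv.piCongrLeft (fun _ => unitInterval × Fin d) σ.symm := by
    funext x
    apply (MeasurableEquiv.piCongrLeft (fun _ => unitInterval × Fin d) σ.symm).symm.injective
    rw [MeasurableEquiv.symm_apply_apply]
    funext i
    change (x ∘ σ) (σ.symm i) = x i
    simp
  rw [e]
  exact h

/-- The subspace of symmetric kernels. -/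
def symmKernel (d k : ℕ) : Submodule ℝ (Kernel d k) where
  carrier := {f | ∀ σ : Equiv.Perm (Fin k),
    (fun x => f (x ∘ σ)) =ᵐ[kernelMeasure d k] fun x => f x}
  zero_mem' := by
    intro σ
    have h0 := Lp.coeFn_zero ℝ 2 (kernelMeasure d k)
    filter_upwards [h0, (measurePreserving_perm d k σ).quasiMeasurePreserving.ae h0]
      with x h1 h2
    rw [h1, h2]; rfl
  add_mem' := by
    intro f g hf hg σ
    have h0 := Lp.coeFn_add f g
    filter_upwards [h0, (measurePreserving_perm d k σ).quasiMeasurePreserving.ae h0, hf σ, hg σ]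
      with x h1 h2 h3 h4
    rw [h1, h2]; simp only [Pi.add_apply]; rw [h3, h4]
  smul_mem' := by
    intro c f hf σ
    have h0 := Lp.coeFn_smul c f
    filter_upwards [h0, (measurePreserving_perm d k σ).quasiMeasurePreserving.ae h0, hf σ]
      with x h1 h2 h3
    rw [h1, h2]; simp only [Pi.smul_apply]; rw [h3]

/-- The cell `(s,t] × {i}` of `[0,1] × {1,…,d}`. -/
def cell (i : Fin d) (s t : unitInterval) : Set (unitInterval × Fin d) := Set.Ioc s t ×ˢ {i}

/-- Elementary pairs: for pairwise disjoint cells `A_l = (s_l,t_l] × {i_l}`, `l = 1,…,k`, the kernel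
`1_{A_1 × ⋯ × A_k}` together with the random variable `∏ l, (w_{i_l}(t_l) - w_{i_l}(s_l))`. -/
def elementaryPairs (w : unitInterval → Ω → EuclideanSpace ℝ (Fin d)) (P : Measure Ω) (k : ℕ) :
    Set (Kernel d k × Lp ℝ 2 P) :=
  {p | ∃ (i : Fin k → Fin d) (s t : Fin k → unitInterval), (∀ l, s l ≤ t l) ∧
    (Pairwise fun l m => Disjoint (cell (i l) (s l) (t l)) (cell (i m) (s m) (t m))) ∧
    p.1 =ᵐ[kernelMeasure d k]
      (Set.univ.pi fun l => cell (i l) (s l) (t l)).indicator (fun _ => (1 : ℝ)) ∧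
    p.2 =ᵐ[P] fun ω => ∏ l, (w (t l) ω (i l) - w (s l) ω (i l))}

/-- The graph of the `k`-fold multiple Itô integral: the linear and continuous extension of the
integral of step kernels vanishing on the diagonals. -/
noncomputable def multipleIntegralGraph (w : unitInterval → Ω → EuclideanSpace ℝ (Fin d))
    (P : Measure Ω) (k : ℕ) : Submodule ℝ (Kernel d k × Lp ℝ 2 P) :=
  (Submodule.span ℝ (elementaryPairs w P k)).topologicalClosure

/-- `X = I_k(f)` is the `k`-fold multiple Itô integral of the kernel `f`. -/
def IsMultipleIntegral (w : unitInterval → Ω → EuclideanSpace ℝ (Fin d)) (P : Measure Ω) (k : ℕ)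
    (f : Kernel d k) (X : Lp ℝ 2 P) : Prop :=
  (f, X) ∈ multipleIntegralGraph w P k

/-- The space of all `k`-fold multiple integrals `I_k(f)` of symmetric kernels `f`. -/
noncomputable def chaos (w : unitInterval → Ω → EuclideanSpace ℝ (Fin d)) (P : Measure Ω) (k : ℕ) :
    Submodule ℝ (Lp ℝ 2 P) :=
  (multipleIntegralGraph w P k ⊓ (symmKernel d k).comap (LinearMap.fst ℝ _ _)).map
    (LinearMap.snd ℝ _ _)

theorem mem_chaos_iff (w : unitInterval → Ω → EuclideanSpace ℝ (Fin d)) (P : Measure Ω) (k : ℕ)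
    (X : Lp ℝ 2 P) :
    X ∈ chaos w P k ↔ ∃ f ∈ symmKernel d k, IsMultipleIntegral w P k f X := by
  simp only [chaos, IsMultipleIntegral, Submodule.mem_map, Submodule.mem_inf, Submodule.mem_comap,
    LinearMap.fst_apply, LinearMap.snd_apply, Prod.exists]
  constructor
  · rintro ⟨f, Y, ⟨h1, h2⟩, rfl⟩
    exact ⟨f, h2, h1⟩
  · rintro ⟨f, h2, h1⟩
    exact ⟨f, X, ⟨h1, h2⟩, rfl⟩

/-! ### Sobolev spaces of generalised Wiener functions -/

/-- Formal Itô–Wiener series `∑ k, η_k`, where `η_k` is a `k`-fold multiple integral. -/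
abbrev FormalSeries (w : unitInterval → Ω → EuclideanSpace ℝ (Fin d)) (P : Measure Ω) : Type _ :=
  (k : ℕ) → chaos w P k

/-- The Sobolev space `𝔻^{2,γ}`. The completion of the finite sums `∑ k, I_k(f_k)` for the norm
`‖∑ k, I_k(f_k)‖² = ∑ k, (k+1)^γ E[I_k(f_k)²]` is realised as the space of formal series
of finite norm. (The norm of `η k` is the `L²(P)` norm.) -/
def sobolevSpace (w : unitInterval → Ω → EuclideanSpace ℝ (Fin d)) (P : Measure Ω) (γ : ℝ) :
    Submodule ℝ (FormalSeries w P) where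
  carrier := {η | Summable fun k : ℕ => ((k : ℝ) + 1) ^ γ * ‖η k‖ ^ 2}
  zero_mem' := by simp [summable_zero]
  add_mem' := by
    intro η ζ hη hζ
    refine Summable.of_nonneg_of_le (fun k => by positivity) (fun k => ?_)
      ((hη.mul_left 2).add (hζ.mul_left 2))
    have h1 : ‖(η + ζ) k‖ ≤ ‖η k‖ + ‖ζ k‖ := norm_add_le _ _
    have h2 : ‖(η + ζ) k‖ ^ 2 ≤ 2 * ‖η k‖ ^ 2 + 2 * ‖ζ k‖ ^ 2 := by
      nlinarith [sq_nonneg (‖η k‖ - ‖ζ k‖), norm_nonneg ((η + ζ) k), norm_nonneg (η k),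
        norm_nonneg (ζ k)]
    have h3 : (0 : ℝ) ≤ ((k : ℝ) + 1) ^ γ := by positivity
    nlinarith [mul_le_mul_of_nonneg_left h2 h3]
  smul_mem' := by
    intro c η hη
    have h : (fun k : ℕ => ((k : ℝ) + 1) ^ γ * ‖(c • η) k‖ ^ 2)
        = fun k : ℕ => ‖c‖ ^ 2 * (((k : ℝ) + 1) ^ γ * ‖η k‖ ^ 2) := by
      funext k
      rw [Pi.smul_apply, norm_smul]; ring
    show Summable _
    rw [h]
    exact Summable.mul_left _ hη

/-- The norm `‖η‖_{2,γ}` of an element of `𝔻^{2,γ}`. -/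
noncomputable def sobolevNorm (w : unitInterval → Ω → EuclideanSpace ℝ (Fin d)) (P : Measure Ω)
    (γ : ℝ) (η : FormalSeries w P) : ℝ :=
  √(∑' k : ℕ, ((k : ℝ) + 1) ^ γ * ‖η k‖ ^ 2)

/-- `ζ` is the Itô–Wiener expansion of the square integrable random variable `X`. -/
def IsExpansion (w : unitInterval → Ω → EuclideanSpace ℝ (Fin d)) (P : Measure Ω)
    (ζ : FormalSeries w P) (X : Lp ℝ 2 P) : Prop :=
  HasSum (fun k => (ζ k : Lp ℝ 2 P)) X

/-- Measurability of a generalised function `η ∈ 𝔻^{2,γ}` with respect to a `σ`-field `𝒜`: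
`η` is a limit in `𝔻^{2,γ}` of square integrable random variables that are (almost surely equal to)
`𝒜`-measurable ones. -/
def IsMeasurableWrt {Ω : Type*} {d : ℕ} (𝒜 : MeasurableSpace Ω) [MeasurableSpace Ω]
    (w : unitInterval → Ω → EuclideanSpace ℝ (Fin d)) (P : Measure Ω) (γ : ℝ)
    (η : FormalSeries w P) : Prop :=
  ∀ ε > 0, ∃ ζ ∈ sobolevSpace w P γ, sobolevNorm w P γ (η - ζ) < ε ∧
    ∃ X : Lp ℝ 2 P, AEStronglyMeasurable[𝒜] (fun ω => X ω) P ∧ IsExpansion w P ζ X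

/-! ### The Wick product -/

/-- The symmetrisation `f ⊗̂ g` of the tensor product of two kernels of orders `i` and `j`,
as a kernel of order `n = i + j`. -/
noncomputable def symmTensor {i j n : ℕ} (hn : i + j = n) (f : Kernel d i) (g : Kernel d j)
    (x : Fin n → unitInterval × Fin d) : ℝ :=
  (n.factorial : ℝ)⁻¹ * ∑ σ : Equiv.Perm (Fin n),
    f (fun a => x (σ (Fin.cast hn (Fin.castAdd j a)))) *
      g (fun b => x (σ (Fin.cast hn (Fin.natAdd i b))))

/-- `ζ = :η₁η₂:` is the Wick product of two formal series `η₁ = ∑ I_k(f_k)` and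
`η₂ = ∑ I_k(g_k)` with symmetric kernels, i.e. `ζ = ∑ n, I_n(∑_{i+j=n} f_i ⊗̂ g_j)`. -/
def IsWickProduct (w : unitInterval → Ω → EuclideanSpace ℝ (Fin d)) (P : Measure Ω)
    (η₁ η₂ ζ : FormalSeries w P) : Prop :=
  ∃ f g h : (k : ℕ) → Kernel d k,
    (∀ k, f k ∈ symmKernel d k ∧ IsMultipleIntegral w P k (f k) (η₁ k)) ∧
    (∀ k, g k ∈ symmKernel d k ∧ IsMultipleIntegral w P k (g k) (η₂ k)) ∧
    ∀ n, (h n =ᵐ[kernelMeasure d n] fun x => ∑ p : Finset.HasAntidiagonal.antidiagonal n,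
        symmTensor (Finset.HasAntidiagonal.mem_antidiagonal.mp p.2) (f p.1.1) (g p.1.2) x) ∧
      IsMultipleIntegral w P n (h n) (ζ n)

end

end WickSobolev

/-!
The Wick product of generalised functions measurable with respect to orthogonal noises is an
isometric tensor product in each pair of degrees, because no contractions can occur.

*Multiple integrals.* The Wiener integral of a Brownian motion is an isonormal Gaussian process `W`
on `L²([0,1], ℝ^d)` (`IsBrownianMotion.exists_isIsonormal`). Gaussian integration by parts
(`IsIsonormal.integral_mul_prod_mul_exp`) computes the mixed moments of products `∏ W(h_l)` of
orthogonal values, with each other and with exponentials `exp (W h)`. This gives the Itô isometry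
`⟪I_k f, I_k g⟫ = ∑_σ ⟪f ∘ σ, g⟫` (`inner_of_isMultipleIntegral`); since the step kernels vanishing
on the diagonals are dense (`dense_span_stepKernel`), `I_k` is defined for all kernels
(`exists_isMultipleIntegral`), and it is injective on symmetric ones. Hence two formal series have
exactly one Wick product (`exists_wickProduct`).

*Measurability.* The pairing of `I_k f` with the exponential vector `exp (W h - ‖h‖²/2)` is
`⟪f, h ⊗ ⋯ ⊗ h⟫` (`inner_expVec`). If `X = ∑ I_k(f_k)` is square integrable and `σ(H)`-measurable,
`u ∈ H` and `v ⟂ H`, then `exp (W v)` is independent of `X exp (W u)`, so that the pairings of `X`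
with the exponential vectors of `u + v` and of `u` agree. Comparing the terms of each degree,
`⟪f_k, (u + v) ⊗ ⋯ ⊗ (u + v)⟫ = ⟪f_k, u ⊗ ⋯ ⊗ u⟫`. As a symmetric kernel is determined by its
inner products with such powers, `f_k` lies in the closed span `symmPower H k` of the powers of
elements of `H`. This passes to limits in `𝔻^{2,γ}` (`mem_symmPower_of_isMeasurableWrt`).

*The norm.* Let `f_i`, `g_j` lie in the symmetric powers of orthogonal subspaces. On generators,
`⟪f_i ⊗ g_j ∘ σ, f_{i'} ⊗ g_{j'}⟫` vanishes unless `i = i'` and `σ` preserves the two groups of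
variables, so `n! ‖∑_{i+j=n} f_i ⊗̂ g_j‖² = ∑_{i+j=n} i! ‖f_i‖² j! ‖g_j‖²`
(`factorial_mul_norm_wickKernel_sq`): the squared norms of the terms of the Wick product are the
convolution of those of the factors. For negative exponents
`(i+j+1)^{γ₁+γ₂} ≤ (i+1)^{γ₁} (j+1)^{γ₂}`, and the claim is a comparison with a Cauchy product.
-/

namespace WickSobolev

open Filter Topology Real
open scoped NNReal ENNReal

/-! ### Random variables with moments of all orders -/

/-- `X` has finite moments of all orders. -/
def HasAllMoments {Ω : Type*} [MeasurableSpace Ω] (X : Ω → ℝ) (P : Measure Ω) : Prop :=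
  ∀ p : ℝ≥0, MemLp X p P

section Moments

variable {Ω : Type*} [MeasurableSpace Ω] {P : Measure Ω}

lemma HasAllMoments.integrable {X : Ω → ℝ} (hX : HasAllMoments X P) : Integrable X P := by
  have := hX 1
  rwa [ENNReal.coe_one, memLp_one_iff_integrable] at this

lemma HasAllMoments.memLp_two {X : Ω → ℝ} (hX : HasAllMoments X P) : MemLp X 2 P := hX 2

lemma HasAllMoments.mul {X Y : Ω → ℝ} (hX : HasAllMoments X P) (hY : HasAllMoments Y P) :
    HasAllMoments (fun ω => X ω * Y ω) P := by
  intro p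
  have : ENNReal.HolderTriple ((2 * p : ℝ≥0) : ℝ≥0∞) ((2 * p : ℝ≥0) : ℝ≥0∞) (p : ℝ≥0∞) := by
    constructor
    rw [ENNReal.coe_mul, ENNReal.mul_inv (by simp) (by simp), ← add_mul]
    simp [ENNReal.inv_two_add_inv_two]
  exact (hY (2 * p)).mul (hX (2 * p))

lemma HasAllMoments.const_mul {X : Ω → ℝ} (c : ℝ) (hX : HasAllMoments X P) :
    HasAllMoments (fun ω => c * X ω) P := fun p => (hX p).const_mul c

lemma HasAllMoments.add {X Y : Ω → ℝ} (hX : HasAllMoments X P) (hY : HasAllMoments Y P) :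
    HasAllMoments (fun ω => X ω + Y ω) P := fun p => (hX p).add (hY p)

variable [IsProbabilityMeasure P]

lemma HasAllMoments.const (c : ℝ) : HasAllMoments (fun _ : Ω => c) P := fun _ => memLp_const c

lemma HasAllMoments.prod {ι : Type*} (s : Finset ι) {X : ι → Ω → ℝ}
    (hX : ∀ i, HasAllMoments (X i) P) : HasAllMoments (fun ω => ∏ i ∈ s, X i ω) P := by
  classical
  induction s using Finset.induction with
  | empty => simpa using HasAllMoments.const 1
  | insert a s ha ih =>
    simp_rw [Finset.prod_insert ha]
    exact (hX a).mul ih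

omit [IsProbabilityMeasure P] in
lemma hasAllMoments_of_hasGaussianLaw {X : Ω → ℝ} (hX : HasGaussianLaw X P) :
    HasAllMoments X P := fun _ => hX.memLp (by simp)

omit [IsProbabilityMeasure P] in
lemma hasAllMoments_exp_of_hasGaussianLaw {X : Ω → ℝ} (hX : HasGaussianLaw X P) :
    HasAllMoments (fun ω => rexp (X ω)) P := by
  intro p
  have hm : AEStronglyMeasurable (fun ω => rexp (X ω)) P :=
    (measurable_exp.comp_aemeasurable hX.aemeasurable).aestronglyMeasurable
  rcases eq_or_ne p 0 with rfl | hp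
  · simpa using hm
  · rw [← integrable_norm_rpow_iff hm (by simpa using hp) (by simp)]
    have h1 : Integrable (fun x => rexp (p * x)) (P.map X) := by
      rw [hX.map_eq_gaussianReal]; exact integrable_exp_mul_gaussianReal _
    have h2 := (integrable_map_measure h1.aestronglyMeasurable hX.aemeasurable).1 h1
    refine h2.congr (ae_of_all _ fun ω => ?_)
    simp only [Function.comp, ENNReal.coe_toReal, norm_eq_abs, abs_exp]
    rw [← exp_mul, mul_comm]

end Moments

/-! ### Gaussian integration by parts -/

lemma hasDerivAt_gaussianPDFReal {v : ℝ≥0} (x : ℝ) :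
    HasDerivAt (gaussianPDFReal 0 v) (-(x / v) * gaussianPDFReal 0 v x) x := by
  have h : HasDerivAt (fun x : ℝ => -(x - 0) ^ 2 / (2 * (v : ℝ))) (-(x / v)) x := by
    have := ((((hasDerivAt_id x).sub_const 0).pow 2).neg).div_const (2 * (v : ℝ))
    convert! this using 1
    simp only [id]
    push_cast
    rcases eq_or_ne (v : ℝ) 0 with h0 | h0
    · simp [h0]
    · field_simp; ring
  have := (h.exp).const_mul (√(2 * π * v))⁻¹
  rw [gaussianPDFReal_def]
  convert! this using 1
  ring

lemma integrable_gaussianReal_iff {v : ℝ≥0} (hv : v ≠ 0) {g : ℝ → ℝ} :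
    Integrable g (gaussianReal 0 v) ↔ Integrable fun z => gaussianPDFReal 0 v z * g z := by
  rw [gaussianReal_of_var_ne_zero _ hv,
    integrable_withDensity_iff_integrable_smul' (measurable_gaussianPDF 0 v)
      (ae_of_all _ fun _ => gaussianPDF_lt_top)]
  simp [toReal_gaussianPDF]

/-- Stein's identity for the centred Gaussian law of variance `v`. -/
lemma integral_id_mul_gaussianReal {v : ℝ≥0} (hv : v ≠ 0) {g g' : ℝ → ℝ}
    (hg : ∀ z, HasDerivAt g (g' z) z) (h0 : Integrable g (gaussianReal 0 v))
    (h1 : Integrable (fun z => z * g z) (gaussianReal 0 v))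
    (h2 : Integrable g' (gaussianReal 0 v)) :
    ∫ z, z * g z ∂gaussianReal 0 v = v * ∫ z, g' z ∂gaussianReal 0 v := by
  have hv' : (v : ℝ) ≠ 0 := by exact_mod_cast hv
  rw [integrable_gaussianReal_iff hv] at h0 h1 h2
  have hd : ∀ z, HasDerivAt (fun z => gaussianPDFReal 0 v z * g z)
      (gaussianPDFReal 0 v z * g' z - (v : ℝ)⁻¹ * (gaussianPDFReal 0 v z * (z * g z))) z := by
    intro z
    convert! (hasDerivAt_gaussianPDFReal (v := v) z).mul (hg z) using 1
    field_simp; ring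
  have := integral_eq_zero_of_hasDerivAt_of_integrable hd (h2.sub (h1.const_mul _)) h0
  rw [integral_sub h2 (h1.const_mul _), integral_const_mul, sub_eq_zero] at this
  rw [integral_gaussianReal_eq_integral_smul hv, integral_gaussianReal_eq_integral_smul hv]
  simp only [smul_eq_mul]
  rw [this]
  field_simp

/-! ### Isonormal Gaussian processes -/

/-- `W` is an isonormal Gaussian process on the real inner product space `V`: a linear isometry into
`L²(P)` whose values are jointly Gaussian and centred. -/
structure IsIsonormal {Ω : Type*} [MeasurableSpace Ω] {P : Measure Ω} {V : Type*}
    [NormedAddCommGroup V] [InnerProductSpace ℝ V] (W : V →ₗᵢ[ℝ] Lp ℝ 2 P) : Prop where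
  gaussian : IsGaussianProcess (fun h ω => W h ω) P
  mean : ∀ h, ∫ ω, W h ω ∂P = 0

namespace IsIsonormal

variable {Ω : Type*} [MeasurableSpace Ω] {P : Measure Ω} [IsProbabilityMeasure P] {V : Type*}
  [NormedAddCommGroup V] [InnerProductSpace ℝ V] {W : V →ₗᵢ[ℝ] Lp ℝ 2 P}

omit [IsProbabilityMeasure P] in
lemma aemeasurable (W : V →ₗᵢ[ℝ] Lp ℝ 2 P) (h : V) : AEMeasurable (fun ω => W h ω) P :=
  (Lp.aestronglyMeasurable (W h)).aemeasurable

omit [IsProbabilityMeasure P] in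
lemma integral_mul (W : V →ₗᵢ[ℝ] Lp ℝ 2 P) (h g : V) :
    ∫ ω, W h ω * W g ω ∂P = inner ℝ h g := by
  rw [← W.inner_map_map, L2.inner_def]
  simp [mul_comm]

lemma covariance_eq (hW : IsIsonormal W) (h g : V) :
    cov[fun ω => W h ω, fun ω => W g ω; P] = inner ℝ h g := by
  rw [covariance_eq_sub (Lp.memLp _) (Lp.memLp _), hW.mean h, zero_mul, sub_zero]
  exact integral_mul W h g

lemma map_eq (hW : IsIsonormal W) (h : V) :
    P.map (fun ω => W h ω) = gaussianReal 0 (‖h‖₊ ^ 2) := by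
  rw [(hW.gaussian.hasGaussianLaw_eval h).map_eq_gaussianReal, hW.mean h]
  congr 1
  rw [← covariance_self (aemeasurable W h), hW.covariance_eq, real_inner_self_eq_norm_sq]
  ext
  simp

omit [IsProbabilityMeasure P] in
lemma hasAllMoments (hW : IsIsonormal W) (h : V) : HasAllMoments (fun ω => W h ω) P :=
  hasAllMoments_of_hasGaussianLaw (hW.gaussian.hasGaussianLaw_eval h)

omit [IsProbabilityMeasure P] in
lemma hasAllMoments_exp (hW : IsIsonormal W) (h : V) :
    HasAllMoments (fun ω => rexp (W h ω)) P :=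
  hasAllMoments_exp_of_hasGaussianLaw (hW.gaussian.hasGaussianLaw_eval h)

lemma integral_exp (hW : IsIsonormal W) (h : V) :
    ∫ ω, rexp (W h ω) ∂P = rexp (‖h‖ ^ 2 / 2) := by
  have := mgf_gaussianReal (hW.map_eq h) 1
  simpa [mgf] using this

omit [IsProbabilityMeasure P] in
lemma coeFn_add (W : V →ₗᵢ[ℝ] Lp ℝ 2 P) (h g : V) :
    ∀ᵐ ω ∂P, W (h + g) ω = W h ω + W g ω := by
  rw [map_add]; exact Lp.coeFn_add _ _

omit [IsProbabilityMeasure P] in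
lemma coeFn_smul (W : V →ₗᵢ[ℝ] Lp ℝ 2 P) (c : ℝ) (h : V) :
    ∀ᵐ ω ∂P, W (c • h) ω = c * W h ω := by
  rw [map_smul]; exact Lp.coeFn_smul _ _

/-- Values of an isonormal process on orthogonal sets are independent. -/
lemma indepFun (hW : IsIsonormal W) (S T : Set V) (h : ∀ a ∈ S, ∀ b ∈ T, inner ℝ a b = 0) :
    IndepFun (fun ω (a : S) => W a ω) (fun ω (b : T) => W b ω) P := by
  refine IsGaussianProcess.indepFun_of_covariance_eq_zero (X := fun (a : S) ω => W a ω)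
    (Y := fun (b : T) ω => W b ω) ?_ (fun _ => aemeasurable W _)
    (fun _ => aemeasurable W _) fun a b => (hW.covariance_eq _ _).trans (h a a.2 b b.2)
  have := hW.gaussian.comp_right (Sum.elim (fun a : S => (a : V)) (fun b : T => (b : V)))
  convert! this using 1
  ext (a | b) <;> rfl

/-- Gaussian integration by parts for a product of values of an isonormal process and an
exponential: conditionally on the part of the process orthogonal to `b`, this is Stein's identity
for the variable `W b`. -/
lemma integral_mul_prod_mul_exp (hW : IsIsonormal W) {ι : Type*} [DecidableEq ι] (s : Finset ι)
    (b : V) (c : ι → V) (h : V) :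
    ∫ ω, W b ω * ((∏ l ∈ s, W (c l) ω) * rexp (W h ω)) ∂P =
      ∑ l ∈ s, inner ℝ b (c l) * ∫ ω, (∏ m ∈ s.erase l, W (c m) ω) * rexp (W h ω) ∂P +
        inner ℝ b h * ∫ ω, (∏ l ∈ s, W (c l) ω) * rexp (W h ω) ∂P := by
  rcases eq_or_ne b 0 with rfl | hb
  · have h0 : ∀ᵐ ω ∂P, W (0 : V) ω = 0 := by rw [map_zero]; exact Lp.coeFn_zero _ _ _
    simp only [inner_zero_left, zero_mul, Finset.sum_const_zero, add_zero]
    refine integral_eq_zero_of_ae ?_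
    filter_upwards [h0] with ω hω
    rw [hω, zero_mul, Pi.zero_apply]
  let v : ℝ≥0 := ‖b‖₊ ^ 2
  have hv : v ≠ 0 := by simpa [v] using hb
  have hv' : (v : ℝ) ≠ 0 := by exact_mod_cast hv
  have hvb : (v : ℝ) = inner ℝ b b := by rw [real_inner_self_eq_norm_sq]; simp [v]
  -- `T` is the orthogonal complement of `b`, and `c = α c • b + r c` with `r c ∈ T`, so that
  -- `W c = α c * W b + W (r c)` with independent summands.
  let T : Set V := {c | inner ℝ b c = 0}
  let α : V → ℝ := fun c => inner ℝ b c / v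
  have hα : ∀ c, v * α c = inner ℝ b c := fun c => by simp only [α]; field_simp
  have hT : ∀ c, c - α c • b ∈ T := by
    intro c
    change inner ℝ b (c - α c • b) = 0
    rw [inner_sub_right, inner_smul_right, ← hvb, ← hα]
    ring
  let r : V → T := fun c => ⟨c - α c • b, hT c⟩
  let Y : Ω → T → ℝ := fun ω c => W c ω
  have hYm : Measurable Y := measurable_pi_lambda _ fun c => (Lp.stronglyMeasurable _).measurable
  have hZm : Measurable (fun ω => W b ω) := (Lp.stronglyMeasurable _).measurable
  have hind : IndepFun (fun ω => W b ω) Y P :=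
    (hW.indepFun {b} T (fun a ha t ht => by rw [Set.mem_singleton_iff.1 ha]; exact ht)).comp
      (measurable_pi_apply (⟨b, rfl⟩ : ({b} : Set V))) measurable_id
  have hdec : ∀ c, ∀ᵐ ω ∂P, W c ω = α c * W b ω + Y ω (r c) := by
    intro c
    have h1 := coeFn_add W (α c • b) (c - α c • b)
    filter_upwards [h1, coeFn_smul W (α c) b] with ω h1 h2
    rw [add_sub_cancel] at h1
    rw [h1, h2]
  have hdecs : ∀ᵐ ω ∂P, ∀ l ∈ s, W (c l) ω = α (c l) * W b ω + Y ω (r (c l)) :=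
    (ae_ball_iff s.countable_toSet).2 fun l _ => hdec (c l)
  -- The integrand as a function of `z = W b` and of the values `y` of `W` on the orthogonal
  -- complement of `b`, for an arbitrary set of factors.
  let G : Finset ι → ℝ → (T → ℝ) → ℝ := fun t z y =>
    (∏ l ∈ t, (α (c l) * z + y (r (c l)))) * rexp (α h * z + y (r h))
  have hGm : ∀ t, Measurable (fun p : (T → ℝ) × ℝ => G t p.2 p.1) := by
    intro t
    fun_prop
  have hG : ∀ t ⊆ s, ∀ᵐ ω ∂P, (∏ l ∈ t, W (c l) ω) * rexp (W h ω) = G t (W b ω) (Y ω) := by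
    intro t ht
    filter_upwards [hdecs, hdec h] with ω h1 h2
    rw [h2, Finset.prod_congr rfl fun l hl => h1 l (ht hl)]
  have hmom : ∀ t, HasAllMoments (fun ω => (∏ l ∈ t, W (c l) ω) * rexp (W h ω)) P := fun t =>
    (HasAllMoments.prod t fun l => hW.hasAllMoments (c l)).mul (hW.hasAllMoments_exp h)
  have hGi : ∀ t ⊆ s, Integrable (fun ω => G t (W b ω) (Y ω)) P := fun t ht =>
    (hmom t).integrable.congr (hG t ht)
  have hGi' : Integrable (fun ω => W b ω * G s (W b ω) (Y ω)) P := by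
    refine ((hW.hasAllMoments b).mul (hmom s)).integrable.congr ?_
    filter_upwards [hG s subset_rfl] with ω hω
    rw [hω]
  let ν := P.map Y
  have : IsProbabilityMeasure ν := Measure.isProbabilityMeasure_map hYm.aemeasurable
  let γ := gaussianReal 0 v
  have hlaw : P.map (fun ω => (Y ω, W b ω)) = ν.prod γ := by
    rw [(indepFun_iff_map_prod_eq_prod_map_map hYm.aemeasurable hZm.aemeasurable).1 hind.symm,
      hW.map_eq b]
  have hfub : ∀ F : (T → ℝ) × ℝ → ℝ, Measurable F → Integrable (fun ω => F (Y ω, W b ω)) P →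
      ∫ ω, F (Y ω, W b ω) ∂P = ∫ y, ∫ z, F (y, z) ∂γ ∂ν := by
    intro F hF hFi
    have hpm : AEMeasurable (fun ω => (Y ω, W b ω)) P := (hYm.prodMk hZm).aemeasurable
    have h1 : Integrable F (ν.prod γ) := by
      rw [← hlaw, integrable_map_measure hF.aestronglyMeasurable hpm]
      exact hFi
    rw [← integral_prod _ h1, ← hlaw, integral_map hpm hF.aestronglyMeasurable]
  let G' : ℝ → (T → ℝ) → ℝ := fun z y =>
    ∑ l ∈ s, α (c l) * G (s.erase l) z y + α h * G s z y
  have hG'i : Integrable (fun ω => G' (W b ω) (Y ω)) P :=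
    (integrable_finsetSum s fun l _ => (hGi _ (s.erase_subset l)).const_mul _).add
      ((hGi s subset_rfl).const_mul _)
  have hG'm : Measurable (fun p : (T → ℝ) × ℝ => G' p.2 p.1) :=
    (Finset.measurable_sum s fun l _ => (hGm _).const_mul _).add ((hGm s).const_mul _)
  have hderiv : ∀ z y, HasDerivAt (fun z => G s z y) (G' z y) z := by
    intro z y
    have hlin : ∀ a e : ℝ, HasDerivAt (fun z => a * z + e) a z := fun a e => by
      simpa using ((hasDerivAt_id z).const_mul a).add_const e
    have h1 := HasDerivAt.fun_finsetProd (u := s) (x := z)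
      (f := fun l z => α (c l) * z + y (r (c l))) (fun l _ => hlin (α (c l)) (y (r (c l))))
    have h2 := h1.mul (hlin (α h) (y (r h))).exp
    convert! h2 using 1
    simp only [G', G, Finset.sum_mul, smul_eq_mul]
    congr 1
    · exact Finset.sum_congr rfl fun l _ => by ring
    · ring
  have hγ : HasGaussianLaw (id : ℝ → ℝ) γ := IsGaussian.hasGaussianLaw_id
  have hzm : HasAllMoments (fun z : ℝ => z) γ := hasAllMoments_of_hasGaussianLaw hγ
  have hGzm : ∀ t y, HasAllMoments (fun z => G t z y) γ := by
    intro t y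
    refine (HasAllMoments.prod t fun l => (hzm.const_mul _).add (HasAllMoments.const _)).mul ?_
    simp_rw [exp_add]
    exact (hasAllMoments_exp_of_hasGaussianLaw (hγ.fun_smul (α h))).mul (HasAllMoments.const _)
  have hstein : ∀ y, ∫ z, z * G s z y ∂γ = v * ∫ z, G' z y ∂γ := by
    intro y
    refine integral_id_mul_gaussianReal hv (fun z => hderiv z y) (hGzm s y).integrable
      (hzm.mul (hGzm s y)).integrable ?_
    exact (integrable_finsetSum s fun l _ => (hGzm _ y).integrable.const_mul _).add
      ((hGzm s y).integrable.const_mul _)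
  calc ∫ ω, W b ω * ((∏ l ∈ s, W (c l) ω) * rexp (W h ω)) ∂P
      = ∫ ω, W b ω * G s (W b ω) (Y ω) ∂P := by
        refine integral_congr_ae ?_
        filter_upwards [hG s subset_rfl] with ω hω
        rw [hω]
    _ = ∫ y, ∫ z, z * G s z y ∂γ ∂ν :=
        hfub (fun p => p.2 * G s p.2 p.1) (measurable_snd.mul (hGm s)) hGi'
    _ = v * ∫ ω, G' (W b ω) (Y ω) ∂P := by
        simp_rw [hstein]
        rw [integral_const_mul, hfub (fun p => G' p.2 p.1) hG'm hG'i]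
    _ = _ := by
        simp only [G']
        rw [integral_add (integrable_finsetSum s fun l _ =>
            (hGi _ (s.erase_subset l)).const_mul _) ((hGi s subset_rfl).const_mul _),
          integral_finsetSum s fun l _ => (hGi _ (s.erase_subset l)).const_mul _]
        simp_rw [integral_const_mul]
        rw [mul_add, Finset.mul_sum, ← mul_assoc, hα, integral_congr_ae (hG s subset_rfl)]
        congr 1
        refine Finset.sum_congr rfl fun l _ => ?_
        rw [← mul_assoc, hα, integral_congr_ae (hG _ (s.erase_subset l))]

/-- The mixed moment of a product of orthogonal values of an isonormal process with an exponential: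
only the terms of the integration by parts that differentiate the exponential contribute. -/
lemma integral_prod_mul_exp (hW : IsIsonormal W) {ι : Type*} [DecidableEq ι] (s : Finset ι)
    (a : ι → V) (ha : Pairwise fun l m => inner ℝ (a l) (a m) = 0) (h : V) :
    ∫ ω, (∏ l ∈ s, W (a l) ω) * rexp (W h ω) ∂P =
      (∏ l ∈ s, inner ℝ (a l) h) * rexp (‖h‖ ^ 2 / 2) := by
  induction s using Finset.induction with
  | empty => simpa using hW.integral_exp h
  | insert l s hl ih =>
    simp_rw [Finset.prod_insert hl, mul_assoc]
    rw [hW.integral_mul_prod_mul_exp s (a l) a h, ih, Finset.sum_eq_zero, zero_add]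
    intro m hm
    rw [ha (ne_of_mem_of_not_mem hm hl).symm, zero_mul]

/-- The covariance of two products of orthogonal values of an isonormal process is the permanent
of the matrix of inner products: integration by parts for `W (a 0)` expands it along a row. -/
lemma integral_prod_mul_prod (hW : IsIsonormal W) {k : ℕ} (a b : Fin k → V)
    (ha : Pairwise fun l m => inner ℝ (a l) (a m) = 0)
    (hb : Pairwise fun l m => inner ℝ (b l) (b m) = 0) :
    ∫ ω, (∏ l, W (a l) ω) * ∏ l, W (b l) ω ∂P =
      ∑ σ : Equiv.Perm (Fin k), ∏ l, inner ℝ (a l) (b (σ l)) := by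
  induction k with
  | zero => simp
  | succ k ih =>
    have h0 : ∀ᵐ ω ∂P, W (0 : V) ω = 0 := by rw [map_zero]; exact Lp.coeFn_zero _ _ _
    -- As `W 0 = 0` almost surely, integration by parts with the exponent `0` concerns
    -- products only.
    have hexp : ∀ F : Ω → ℝ, ∫ ω, F ω * rexp (W 0 ω) ∂P = ∫ ω, F ω ∂P := fun F =>
      integral_congr_ae (by filter_upwards [h0] with ω hω; rw [hω, Real.exp_zero, mul_one])
    let c : Fin k ⊕ Fin (k + 1) → V := Sum.elim (fun l => a l.succ) b
    have hS := hW.integral_mul_prod_mul_exp Finset.univ (a 0) c 0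
    have hexp' : ∀ F : Ω → ℝ, ∫ ω, W (a 0) ω * (F ω * rexp (W 0 ω)) ∂P =
        ∫ ω, W (a 0) ω * F ω ∂P := fun F => by simp_rw [← mul_assoc]; rw [hexp]
    rw [hexp', inner_zero_right, zero_mul, add_zero] at hS
    simp_rw [hexp] at hS
    have hL : ∫ ω, (∏ l, W (a l) ω) * ∏ l, W (b l) ω ∂P = ∫ ω, W (a 0) ω * ∏ l, W (c l) ω ∂P := by
      congr 1; ext ω
      rw [Fin.prod_univ_succ, Fintype.prod_sum_type, mul_assoc]
      rfl
    rw [hL, hS, Fintype.sum_sum_type]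
    have hz : ∑ l : Fin k, inner ℝ (a 0) (c (Sum.inl l)) *
        ∫ ω, ∏ m ∈ Finset.univ.erase (Sum.inl l), W (c m) ω ∂P = 0 :=
      Finset.sum_eq_zero fun l _ => by
        rw [show inner ℝ (a 0) (c (Sum.inl l)) = 0 from ha (Fin.succ_ne_zero l).symm, zero_mul]
    rw [hz, zero_add, ← Equiv.Perm.decomposeFin.symm.sum_comp, Fintype.sum_prod_type]
    refine Finset.sum_congr rfl fun m _ => ?_
    -- The indices other than `m` are enumerated as in `Equiv.Perm.decomposeFin`.
    have hprod : ∀ f : Fin k ⊕ Fin (k + 1) → ℝ, ∏ x ∈ Finset.univ.erase (Sum.inr m), f x =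
        (∏ l, f (Sum.inl l)) * ∏ l : Fin k, f (Sum.inr (Equiv.swap 0 m l.succ)) := by
      intro f
      have e1 : Finset.univ.erase (Sum.inr m : Fin k ⊕ Fin (k + 1)) =
          Finset.univ.disjSum (Finset.univ.erase m) := by ext (x | x) <;> simp
      have e2 : Finset.univ.erase m = Finset.univ.image fun l : Fin k => Equiv.swap 0 m l.succ := by
        ext x
        simp only [Finset.mem_erase, Finset.mem_univ, and_true, Finset.mem_image, true_and]
        constructor
        · intro hx
          obtain ⟨l, hl⟩ := Fin.exists_succ_eq.2 (show Equiv.swap 0 m x ≠ 0 by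
            intro h; apply hx; simpa using congrArg (Equiv.swap 0 m) h)
          exact ⟨l, by rw [hl, Equiv.swap_apply_self]⟩
        · rintro ⟨l, rfl⟩ h
          exact Fin.succ_ne_zero l (by simpa using congrArg (Equiv.swap 0 m) h)
      rw [e1, Finset.prod_disjSum, e2, Finset.prod_image]
      intro x _ y _ hxy
      simpa using hxy
    simp_rw [hprod, c, Sum.elim_inl, Sum.elim_inr]
    rw [ih (fun l => a l.succ) (fun l => b (Equiv.swap 0 m l.succ))
      (fun l l' hl => ha (by simpa using hl)) (fun l l' hl => hb (by simpa using hl)),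
      Finset.mul_sum]
    refine Finset.sum_congr rfl fun e _ => ?_
    rw [Fin.prod_univ_succ]
    simp

end IsIsonormal

/-! ### Linear relations given as closed spans -/

section Relations

variable {E F : Type*} [NormedAddCommGroup E] [InnerProductSpace ℝ E] [NormedAddCommGroup F]
  [InnerProductSpace ℝ F]

/-- Continuous linear maps that agree on a set agree on its closed span. -/
lemma eq_of_mem_closure_span {E F : Type*} [AddCommGroup E] [Module ℝ E] [TopologicalSpace E]
    [ContinuousAdd E] [ContinuousConstSMul ℝ E] [AddCommGroup F] [Module ℝ F] [TopologicalSpace F]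
    [T2Space F] {A : Set E} {L M : E →L[ℝ] F} (h : ∀ x ∈ A, L x = M x) {x : E}
    (hx : x ∈ (Submodule.span ℝ A).topologicalClosure) : L x = M x := by
  have h1 : Submodule.span ℝ A ≤ LinearMap.eqLocus L.toLinearMap M.toLinearMap :=
    Submodule.span_le.2 h
  have h2 : IsClosed (LinearMap.eqLocus L.toLinearMap M.toLinearMap : Set E) :=
    isClosed_eq L.continuous M.continuous
  exact Submodule.topologicalClosure_minimal _ h1 h2 hx

/-- If the inner product of the second components is a bounded bilinear form in the first ones for
elements of `A`, then so it is on the closed span. -/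
lemma inner_snd_of_mem_closure_span {A : Set (E × F)} (B : E →L[ℝ] E →L[ℝ] ℝ)
    (hA : ∀ p ∈ A, ∀ q ∈ A, inner ℝ p.2 q.2 = B p.1 q.1) {p q : E × F}
    (hp : p ∈ (Submodule.span ℝ A).topologicalClosure)
    (hq : q ∈ (Submodule.span ℝ A).topologicalClosure) : inner ℝ p.2 q.2 = B p.1 q.1 := by
  have h1 : ∀ p ∈ A, inner ℝ p.2 q.2 = B p.1 q.1 := fun p hp =>
    eq_of_mem_closure_span (L := (innerSL ℝ p.2).comp (ContinuousLinearMap.snd ℝ E F))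
      (M := (B p.1).comp (ContinuousLinearMap.fst ℝ E F)) (fun q hq => hA p hp q hq) hq
  have h2 := eq_of_mem_closure_span (L := (innerSL ℝ q.2).comp (ContinuousLinearMap.snd ℝ E F))
      (M := (B.flip q.1).comp (ContinuousLinearMap.fst ℝ E F))
      (fun p hp => (real_inner_comm _ _).trans (h1 p hp)) hp
  exact (real_inner_comm _ _).trans h2

/-- A closed linear relation that is bounded and densely defined is everywhere defined. -/
lemma exists_mem_of_bounded_of_dense [CompleteSpace F] (G : Submodule ℝ (E × F))
    (hG : IsClosed (G : Set (E × F))) {C : ℝ} (hC : ∀ p ∈ G, ‖p.2‖ ≤ C * ‖p.1‖)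
    (hd : Dense (Prod.fst '' (G : Set (E × F)))) (e : E) : ∃ f, (e, f) ∈ G := by
  obtain ⟨u, hu, hlim⟩ := mem_closure_iff_seq_limit.1 (hd e)
  choose p hp hpu using hu
  have hcau : CauchySeq fun n => (p n).2 := by
    have hu := cauchySeq_iff_tendsto_dist_atTop_0.1 hlim.cauchySeq
    refine cauchySeq_iff_tendsto_dist_atTop_0.2 (squeeze_zero (fun _ => dist_nonneg) (fun n => ?_)
      (by simpa using hu.const_mul C))
    have := hC _ (G.sub_mem (hp n.1) (hp n.2))
    rwa [Prod.fst_sub, Prod.snd_sub, hpu, hpu, ← dist_eq_norm, ← dist_eq_norm] at this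
  obtain ⟨f, hf⟩ := cauchySeq_tendsto_of_complete hcau
  refine ⟨f, hG.mem_of_tendsto (b := atTop) (f := p) ?_ (Eventually.of_forall hp)⟩
  have h1 : Tendsto (fun n => (p n).1) atTop (𝓝 e) := by simpa only [hpu] using hlim
  exact h1.prodMk_nhds hf

/-- A linear relation that preserves norms and is everywhere defined is the graph of a linear
isometry. -/
lemma exists_linearIsometry_of_norm_eq (G : Submodule ℝ (E × F)) (hG : ∀ p ∈ G, ‖p.2‖ = ‖p.1‖)
    (hd : ∀ e, ∃ f, (e, f) ∈ G) : ∃ L : E →ₗᵢ[ℝ] F, ∀ e f, (e, f) ∈ G ↔ f = L e := by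
  have huniq : ∀ {e f f'}, (e, f) ∈ G → (e, f') ∈ G → f = f' := by
    intro e f f' h h'
    simpa [sub_eq_zero] using hG _ (G.sub_mem h h')
  choose L hL using hd
  refine ⟨⟨⟨⟨L, fun a b => huniq (hL _) (G.add_mem (hL a) (hL b))⟩,
    fun c a => huniq (hL _) (G.smul_mem c (hL a))⟩, fun a => hG _ (hL a)⟩, fun e f =>
    ⟨fun h => huniq h (hL e), ?_⟩⟩
  rintro rfl
  exact hL e

end Relations

/-- An integrable function whose integrals over the whole space and over the sets of a generating
`π`-system vanish is zero almost everywhere. -/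
lemma ae_eq_zero_of_setIntegral_piSystem {α : Type*} [m : MeasurableSpace α] {μ : Measure α}
    {f : α → ℝ} (hf : Integrable f μ) {C : Set (Set α)} (hC : m = MeasurableSpace.generateFrom C)
    (hpi : IsPiSystem C) (huniv : ∫ x, f x ∂μ = 0) (h : ∀ s ∈ C, ∫ x in s, f x ∂μ = 0) :
    f =ᵐ[μ] 0 := by
  suffices H : ∀ s, MeasurableSet s → ∫ x in s, f x ∂μ = 0 from
    hf.ae_eq_zero_of_forall_setIntegral_eq_zero fun s hs _ => H s hs
  intro s hs
  induction s, hs using MeasurableSpace.induction_on_inter hC hpi with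
  | empty => simp
  | basic t ht => exact h t ht
  | compl t ht ih =>
    have := integral_add_compl ht hf
    rwa [ih, zero_add, huniv] at this
  | iUnion g hd hg ih =>
    rw [integral_iUnion hg hd hf.integrableOn]
    simp [ih]

/-! ### The Wiener integral -/

section Brownian

variable {Ω : Type*} [MeasurableSpace Ω] {P : Measure Ω} {d : ℕ}
  {w : unitInterval → Ω → EuclideanSpace ℝ (Fin d)}

lemma integral_coord_mul_coord_stdGaussian (i j : Fin d) :
    ∫ x, x i * x j ∂stdGaussian (EuclideanSpace ℝ (Fin d)) = if i = j then 1 else 0 := by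
  have h := covarianceBilin_apply (μ := stdGaussian (EuclideanSpace ℝ (Fin d)))
    (IsGaussian.memLp_two_id) (EuclideanSpace.single i 1) (EuclideanSpace.single j 1)
  rw [covarianceBilin_stdGaussian] at h
  have h2 : innerSL ℝ (EuclideanSpace.single i (1 : ℝ)) (EuclideanSpace.single j 1) =
      if i = j then 1 else 0 := by
    simp [EuclideanSpace.inner_single_left]
  rw [← h2, h]
  simp [integral_id_stdGaussian, EuclideanSpace.inner_single_left]

lemma integral_coord_stdGaussian (i : Fin d) :
    ∫ x, x i ∂stdGaussian (EuclideanSpace ℝ (Fin d)) = 0 :=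
  integral_strongDual_stdGaussian (EuclideanSpace.proj (𝕜 := ℝ) i)

namespace IsBrownianMotion

lemma hasGaussianLaw_sub (hw : IsBrownianMotion w P) {s t : unitInterval} (hst : s ≤ t) :
    HasGaussianLaw (fun ω => w t ω - w s ω) P := by
  have : IsGaussian ((stdGaussian (EuclideanSpace ℝ (Fin d))).map
      (fun x => √((t : ℝ) - s) • x)) :=
    inferInstanceAs (IsGaussian ((stdGaussian (EuclideanSpace ℝ (Fin d))).map
      (√((t : ℝ) - s) • ContinuousLinearMap.id ℝ (EuclideanSpace ℝ (Fin d)))))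
  exact (hw.law s t hst).hasGaussianLaw

lemma ae_eq_sub_zero (hw : IsBrownianMotion w P) (t : unitInterval) :
    (fun ω => w t ω - w 0 ω) =ᵐ[P] w t := by
  filter_upwards [hw.start] with ω h
  simp [h]

lemma isGaussianProcess (hw : IsBrownianMotion w P) : IsGaussianProcess w P :=
  HasIndepIncrements.isGaussianProcess
    (fun t => (hw.hasGaussianLaw_sub unitInterval.nonneg').congr (hw.ae_eq_sub_zero t))
    hw.start hw.indep

lemma isGaussianProcess_coord (hw : IsBrownianMotion w P) :
    IsGaussianProcess (fun (q : unitInterval × Fin d) ω => w q.1 ω q.2) P := by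
  have h := hw.isGaussianProcess.comp_right (fun q : unitInterval × Fin d => q.1)
  exact h.comp_left (fun q => EuclideanSpace.proj (𝕜 := ℝ) q.2)

lemma memLp_coord (hw : IsBrownianMotion w P) (t : unitInterval) (i : Fin d) :
    MemLp (fun ω => w t ω i) 2 P :=
  (hw.isGaussianProcess_coord.hasGaussianLaw_eval (t, i)).memLp_two

lemma integral_sub_coord_mul (hw : IsBrownianMotion w P) {s t : unitInterval} (hst : s ≤ t)
    (i j : Fin d) : ∫ ω, (w t ω - w s ω) i * (w t ω - w s ω) j ∂P =
      if i = j then (t : ℝ) - s else 0 := by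
  have hst' : (0 : ℝ) ≤ t - s := sub_nonneg.2 hst
  have h := (hw.law s t hst).integral_comp
    (f := fun x : EuclideanSpace ℝ (Fin d) => x i * x j) (by fun_prop)
  refine h.trans ?_
  rw [integral_map (by fun_prop) (by fun_prop)]
  simp only [PiLp.smul_apply, smul_eq_mul]
  calc ∫ x : EuclideanSpace ℝ (Fin d), √((t : ℝ) - s) * x i * (√((t : ℝ) - s) * x j)
        ∂stdGaussian (EuclideanSpace ℝ (Fin d))
      = ∫ x : EuclideanSpace ℝ (Fin d), ((t : ℝ) - s) * (x i * x j)
        ∂stdGaussian (EuclideanSpace ℝ (Fin d)) := by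
        congr 1; ext x
        rw [mul_mul_mul_comm, mul_self_sqrt hst']
    _ = _ := by
        rw [integral_const_mul, integral_coord_mul_coord_stdGaussian]
        split_ifs <;> simp

lemma integral_sub_coord (hw : IsBrownianMotion w P) {s t : unitInterval} (hst : s ≤ t)
    (i : Fin d) : ∫ ω, (w t ω - w s ω) i ∂P = 0 := by
  have h := (hw.law s t hst).integral_comp
    (f := fun x : EuclideanSpace ℝ (Fin d) => x i) (by fun_prop)
  refine h.trans ?_
  rw [integral_map (by fun_prop) (by fun_prop)]
  simp only [PiLp.smul_apply, smul_eq_mul]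
  rw [integral_const_mul, integral_coord_stdGaussian, mul_zero]

lemma integral_coord (hw : IsBrownianMotion w P) (t : unitInterval) (i : Fin d) :
    ∫ ω, w t ω i ∂P = 0 := by
  rw [← hw.integral_sub_coord (unitInterval.nonneg' (t := t)) i]
  refine integral_congr_ae ?_
  filter_upwards [hw.ae_eq_sub_zero t] with ω h
  rw [h]

lemma integral_coord_mul_coord [IsProbabilityMeasure P] (hw : IsBrownianMotion w P)
    (s t : unitInterval) (i j : Fin d) :
    ∫ ω, w s ω i * w t ω j ∂P = if i = j then min (s : ℝ) t else 0 := by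
  wlog hst : s ≤ t generalizing s t i j
  · have := this t s j i (le_of_not_ge hst)
    simp_rw [mul_comm (w s _ i), this, min_comm (s : ℝ), eq_comm]
  have hind := hw.indep.indepFun_eval_sub (unitInterval.nonneg' (t := s)) hst hw.start
  have hind' : IndepFun (fun ω => w s ω i) (fun ω => (w t ω - w s ω) j) P :=
    hind.comp (φ := fun x : EuclideanSpace ℝ (Fin d) => x i)
      (ψ := fun x : EuclideanSpace ℝ (Fin d) => x j) (by fun_prop) (by fun_prop)
  have hm : MemLp (fun ω => (w t ω - w s ω) j) 2 P :=
    (hw.memLp_coord t j).sub (hw.memLp_coord s j)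
  have h1 := hind'.integral_fun_mul_eq_mul_integral (hw.memLp_coord s i).1 hm.1
  rw [hw.integral_sub_coord hst, mul_zero] at h1
  have h2 : ∫ ω, w s ω i * w s ω j ∂P = if i = j then (s : ℝ) else 0 := by
    have := hw.integral_sub_coord_mul (unitInterval.nonneg' (t := s)) i j
    rw [show ((0 : unitInterval) : ℝ) = 0 from rfl, sub_zero] at this
    rw [← this]
    refine integral_congr_ae ?_
    filter_upwards [hw.ae_eq_sub_zero s] with ω h
    rw [h]
  have h3 := integral_add ((hw.memLp_coord s i).integrable_mul hm)
    ((hw.memLp_coord s i).integrable_mul (hw.memLp_coord s j))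
  simp only [Pi.mul_apply] at h3
  rw [h1, h2, zero_add] at h3
  rw [min_eq_left (show (s : ℝ) ≤ t from hst), ← h3]
  congr 1; ext ω
  simp only [PiLp.sub_apply]
  ring

end IsBrownianMotion

/-- The element `1_{(s,t]} e_i` of `L²([0,1], ℝ^d)`. -/
noncomputable def stepVec (i : Fin d) (s t : unitInterval) : NoiseSpace d :=
  indicatorConstLp 2 (measurableSet_Ioc (a := s) (b := t)) (measure_ne_top _ _)
    (EuclideanSpace.single i (1 : ℝ))

lemma inner_stepVec (i : Fin d) (s t : unitInterval) (f : NoiseSpace d) :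
    inner ℝ (stepVec i s t) f = ∫ x in Set.Ioc s t, f x i := by
  have hf : Integrable (fun x => f x) (volume.restrict (Set.Ioc s t)) :=
    ((Lp.memLp f).integrable (by norm_num)).integrableOn
  rw [stepVec, L2.inner_indicatorConstLp_eq_inner_setIntegral, EuclideanSpace.inner_single_left]
  simpa using (ContinuousLinearMap.integral_comp_comm
    (EuclideanSpace.proj (𝕜 := ℝ) i : EuclideanSpace ℝ (Fin d) →L[ℝ] ℝ) hf).symm

lemma inner_stepVec_stepVec (i j : Fin d) (s t s' t' : unitInterval) :
    inner ℝ (stepVec i s t) (stepVec j s' t') =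
      if i = j then max (min (t : ℝ) t' - max (s : ℝ) s') 0 else 0 := by
  rw [inner_stepVec]
  have h : ∀ᵐ x, (stepVec j s' t' : NoiseSpace d) x i =
      (Set.Ioc s' t').indicator (fun _ => if i = j then (1 : ℝ) else 0) x := by
    filter_upwards [indicatorConstLp_coeFn (p := 2) (hs := measurableSet_Ioc (a := s') (b := t'))
      (hμs := measure_ne_top volume _) (c := EuclideanSpace.single j (1 : ℝ))] with x hx
    rw [stepVec, hx]
    by_cases hm : x ∈ Set.Ioc s' t' <;> simp [hm]
  rw [integral_congr_ae (ae_restrict_of_ae h), setIntegral_indicator measurableSet_Ioc,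
    Set.Ioc_inter_Ioc, setIntegral_const]
  split_ifs
  · rw [smul_eq_mul, mul_one, measureReal_def, unitInterval.volume_Ioc, ENNReal.toReal_ofReal']
    simp [Monotone.map_min (show Monotone ((↑) : unitInterval → ℝ) from fun _ _ h => h),
      Monotone.map_max (show Monotone ((↑) : unitInterval → ℝ) from fun _ _ h => h)]
  · simp

lemma dense_span_stepVec :
    (Submodule.span ℝ {h : NoiseSpace d | ∃ s t i, s ≤ t ∧ h = stepVec i s t}).topologicalClosure
      = ⊤ := by
  rw [Submodule.topologicalClosure_eq_top_iff, Submodule.eq_bot_iff]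
  intro f hf
  have h0 : ∀ i s t, s ≤ t → ∫ x in Set.Ioc s t, f x i = 0 := by
    intro i s t hst
    rw [← inner_stepVec]
    exact hf _ (Submodule.subset_span ⟨s, t, i, hst, rfl⟩)
  have hfi : ∀ i, Integrable (fun x => f x i) := fun i =>
    (EuclideanSpace.proj (𝕜 := ℝ) i : EuclideanSpace ℝ (Fin d) →L[ℝ] ℝ).integrable_comp
      ((Lp.memLp f).integrable (by norm_num))
  have h1 : ∀ i, (fun x => f x i) =ᵐ[volume] 0 := by
    intro i
    have hIic : ∀ t, ∫ x in Set.Iic t, f x i = 0 := by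
      intro t
      rw [← h0 i 0 t unitInterval.nonneg']
      refine setIntegral_congr_set ?_
      have : Set.Iic t = Set.Icc 0 t := by ext x; simp
      rw [this]
      exact Ioc_ae_eq_Icc.symm
    refine ae_eq_zero_of_setIntegral_piSystem (hfi i)
      ((borel_eq_generateFrom_Iic unitInterval).symm ▸ BorelSpace.measurable_eq) isPiSystem_Iic
      ?_ ?_
    · have h := hIic 1
      rwa [show Set.Iic (1 : unitInterval) = Set.univ from by ext x; simp [unitInterval.le_one'],
        setIntegral_univ] at h
    · rintro _ ⟨t, rfl⟩
      exact hIic t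
  rw [Lp.eq_zero_iff_ae_eq_zero]
  filter_upwards [ae_all_iff.2 h1] with x hx
  ext i
  exact hx i

/-- The characteristic function is a continuous function of the random variable in `L²`. -/
lemma continuous_integral_cexp [IsProbabilityMeasure P] (u : ℝ) :
    Continuous fun X : Lp ℝ 2 P => ∫ ω, Complex.exp (Complex.I * (u * X ω : ℝ)) ∂P := by
  have hi : ∀ X : Lp ℝ 2 P, Integrable (fun ω => Complex.exp (Complex.I * (u * X ω : ℝ))) P := by
    intro X
    refine Integrable.of_bound (C := 1) ?_ (ae_of_all _ fun ω => ?_)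
    · have := (Lp.stronglyMeasurable X).measurable
      exact Measurable.aestronglyMeasurable (by fun_prop)
    · rw [mul_comm, Complex.norm_exp_ofReal_mul_I]
  refine (LipschitzWith.of_dist_le_mul (K := ‖u‖₊) fun X Y => ?_).continuous
  rw [dist_eq_norm, ← integral_sub (hi X) (hi Y)]
  have h1 : ∀ ω, ‖Complex.exp (Complex.I * (u * X ω : ℝ)) - Complex.exp (Complex.I * (u * Y ω : ℝ))‖
      ≤ |u| * ‖X ω - Y ω‖ := by
    intro ω
    have e : Complex.exp (Complex.I * (u * X ω : ℝ)) = Complex.exp (Complex.I * (u * Y ω : ℝ)) *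
        Complex.exp (Complex.I * (u * (X ω - Y ω) : ℝ)) := by
      rw [← Complex.exp_add]; congr 1; push_cast; ring
    have e2 : Complex.exp (Complex.I * (u * X ω : ℝ)) - Complex.exp (Complex.I * (u * Y ω : ℝ)) =
        Complex.exp (Complex.I * (u * Y ω : ℝ)) *
        (Complex.exp (Complex.I * (u * (X ω - Y ω) : ℝ)) - 1) := by rw [e]; ring
    rw [e2, norm_mul, mul_comm Complex.I, Complex.norm_exp_ofReal_mul_I, one_mul]
    refine (Real.norm_exp_I_mul_ofReal_sub_one_le).trans ?_
    rw [norm_mul, norm_eq_abs u]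
  have hs : MemLp (fun ω => X ω - Y ω) 2 P := (Lp.memLp X).sub (Lp.memLp Y)
  calc _ ≤ ∫ ω, |u| * ‖X ω - Y ω‖ ∂P :=
        norm_integral_le_of_norm_le ((hs.integrable (by norm_num)).norm.const_mul _)
          (ae_of_all _ h1)
    _ = |u| * ∫ ω, ‖X ω - Y ω‖ ∂P := integral_const_mul _ _
    _ ≤ |u| * dist X Y := by
        refine mul_le_mul_of_nonneg_left ?_ (abs_nonneg u)
        rw [dist_eq_norm, Lp.norm_def, integral_norm_eq_lintegral_enorm hs.1,
          ← eLpNorm_one_eq_lintegral_enorm]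
        refine ENNReal.toReal_mono (Lp.eLpNorm_ne_top _) ?_
        rw [eLpNorm_congr_ae (Lp.coeFn_sub X Y)]
        exact eLpNorm_le_eLpNorm_of_exponent_le (by norm_num) hs.1
    _ = _ := by simp

/-- A limit in `L²` of centred Gaussian variables is a centred Gaussian variable. -/
lemma hasGaussianLaw_of_mem_closure [IsProbabilityMeasure P] {S : Set (Lp ℝ 2 P)}
    (hS : ∀ X ∈ S, HasGaussianLaw (fun ω => X ω) P ∧ ∫ ω, X ω ∂P = 0) {X : Lp ℝ 2 P}
    (hX : X ∈ closure S) : HasGaussianLaw (fun ω => X ω) P ∧ ∫ ω, X ω ∂P = 0 := by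
  have hmeas : ∀ X : Lp ℝ 2 P, AEMeasurable (fun ω => X ω) P := fun X =>
    (Lp.stronglyMeasurable X).measurable.aemeasurable
  have hchar : ∀ (X : Lp ℝ 2 P) (u : ℝ), charFun (P.map fun ω => X ω) u =
      ∫ ω, Complex.exp (Complex.I * (u * X ω : ℝ)) ∂P := by
    intro X u
    rw [charFun_apply_real, integral_map (hmeas X) (by fun_prop)]
    congr 1; ext ω; congr 1; push_cast; ring
  have hmean : X ∈ {X : Lp ℝ 2 P | ∫ ω, X ω ∂P = 0} := by
    refine closure_minimal (fun Y hY => (hS Y hY).2) ?_ hX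
    have : ∀ X : Lp ℝ 2 P, ∫ ω, X ω ∂P = inner ℝ
        (indicatorConstLp 2 MeasurableSet.univ (measure_ne_top P _) (1 : ℝ)) X := fun X => by
      rw [L2.inner_indicatorConstLp_one, setIntegral_univ]
    simp_rw [this]
    exact isClosed_eq (by fun_prop) continuous_const
  have hcl : X ∈ {X : Lp ℝ 2 P | ∀ u : ℝ, ∫ ω, Complex.exp (Complex.I * (u * X ω : ℝ)) ∂P =
      Complex.exp (-((‖X‖ ^ 2 : ℝ) * u ^ 2 / 2))} := by
    refine closure_minimal (fun Y hY u => ?_) ?_ hX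
    · have hvar : Var[fun ω => Y ω; P] = ‖Y‖ ^ 2 := by
        rw [variance_of_integral_eq_zero (hmeas Y) (hS Y hY).2, ← real_inner_self_eq_norm_sq,
          L2.inner_def]
        congr 1; ext ω; simp
      rw [← hchar, (hS Y hY).1.map_eq_gaussianReal, (hS Y hY).2, hvar, charFun_gaussianReal]
      congr 1
      rw [Real.coe_toNNReal _ (sq_nonneg _)]
      push_cast
      ring
    · simp only [Set.ofPred_forall]
      refine isClosed_iInter fun u => isClosed_eq (continuous_integral_cexp u) (by fun_prop)
  refine ⟨⟨?_⟩, hmean⟩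
  have : P.map (fun ω => X ω) = gaussianReal 0 (‖X‖₊ ^ 2) := by
    have := Measure.isProbabilityMeasure_map (hmeas X)
    refine Measure.ext_of_charFun (funext fun u => ?_)
    rw [hchar, hcl u, charFun_gaussianReal]
    congr 1
    push_cast
    ring
  rw [this]
  infer_instance

/-- Finite-dimensional marginals of a linear family of Gaussian variables are Gaussian. -/
lemma isGaussianProcess_of_linearMap [IsProbabilityMeasure P] {V : Type*} [AddCommGroup V]
    [Module ℝ V] (W : V →ₗ[ℝ] Lp ℝ 2 P) (hW : ∀ h, HasGaussianLaw (fun ω => W h ω) P) :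
    IsGaussianProcess (fun h ω => W h ω) P := by
  classical
  refine ⟨fun I => ?_⟩
  have hm : Measurable (fun ω => I.restrict fun h => W h ω) :=
    measurable_pi_lambda _ fun h => (Lp.stronglyMeasurable _).measurable
  refine ⟨⟨fun L => ?_⟩⟩
  have hL : ∀ᵐ ω ∂P, W (∑ h : I, L (Pi.single h 1) • (h : V)) ω =
      L (I.restrict fun h => W h ω) := by
    have h1 : ∀ᵐ ω ∂P, ∀ h : I, W (L (Pi.single h 1) • (h : V)) ω = L (Pi.single h 1) * W h ω :=
      ae_all_iff.2 fun h => by rw [map_smul]; exact Lp.coeFn_smul _ _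
    rw [map_sum]
    filter_upwards [h1, Lp.coeFn_fun_finsetSum Finset.univ
      fun h : I => W (L (Pi.single h 1) • (h : V))] with ω h1 h2
    rw [h2]
    simp_rw [h1]
    conv_rhs => rw [← ContinuousLinearMap.coe_coe, LinearMap.pi_apply_eq_sum_univ L.toLinearMap]
    refine Finset.sum_congr rfl fun h _ => ?_
    have hs : (Pi.single h 1 : I → ℝ) = fun j => if h = j then 1 else 0 := by
      ext j; simp [Pi.single_apply, eq_comm]
    rw [smul_eq_mul, mul_comm, hs]
    rfl
  have hg := (hW (∑ h : I, L (Pi.single h 1) • (h : V))).congr hL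
  rw [Measure.map_map L.measurable hm, integral_map hm.aemeasurable (by fun_prop),
    variance_map (by fun_prop) hm.aemeasurable]
  exact hg.map_eq_gaussianReal

lemma coeFn_stepVec (i : Fin d) (s t : unitInterval) : (stepVec i s t : NoiseSpace d) =ᵐ[volume]
    (Set.Ioc s t).indicator (fun _ => EuclideanSpace.single i (1 : ℝ)) :=
  indicatorConstLp_coeFn (hs := measurableSet_Ioc) (hμs := measure_ne_top _ _)

lemma eq_stepVec {s t : unitInterval} {i : Fin d} {h : NoiseSpace d} (hh : h =ᵐ[volume]
    (Set.Ioc s t).indicator (fun _ => EuclideanSpace.single i (1 : ℝ))) : h = stepVec i s t :=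
  Lp.ext (hh.trans (coeFn_stepVec i s t).symm)

namespace IsBrownianMotion

variable [IsProbabilityMeasure P]

/-- The Itô isometry for increments of the Brownian motion. -/
lemma inner_increments (hw : IsBrownianMotion w P) {s t s' t' : unitInterval} (hst : s ≤ t)
    (hst' : s' ≤ t') (i i' : Fin d) {X X' : Lp ℝ 2 P}
    (hX : X =ᵐ[P] fun ω => w t ω i - w s ω i) (hX' : X' =ᵐ[P] fun ω => w t' ω i' - w s' ω i') :
    inner ℝ X X' = inner ℝ (stepVec i s t) (stepVec i' s' t') := by
  rw [inner_stepVec_stepVec]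
  have hI : ∀ (r r' : unitInterval), Integrable (fun ω => w r ω i * w r' ω i') P := fun r r' =>
    (hw.memLp_coord r i).integrable_mul (hw.memLp_coord r' i')
  have h1 : inner ℝ X X' = ∫ ω, ((w t ω i * w t' ω i' - w t ω i * w s' ω i') -
        (w s ω i * w t' ω i' - w s ω i * w s' ω i')) ∂P := by
    rw [L2.inner_def]
    refine integral_congr_ae ?_
    filter_upwards [hX, hX'] with ω h1 h2
    rw [h1, h2]
    simp only [RCLike.inner_apply, conj_trivial]
    ring
  have h2 := integral_sub ((hI t t').sub (hI t s')) ((hI s t').sub (hI s s'))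
  simp only [Pi.sub_apply] at h2
  rw [h1, h2, integral_sub (hI _ _) (hI _ _), integral_sub (hI _ _) (hI _ _)]
  simp_rw [hw.integral_coord_mul_coord]
  split_ifs
  · have h1 : (s : ℝ) ≤ t := hst
    have h2 : (s' : ℝ) ≤ t' := hst'
    grind
  · simp

lemma inner_of_mem_wienerGraph (hw : IsBrownianMotion w P) {p q : NoiseSpace d × Lp ℝ 2 P}
    (hp : p ∈ wienerGraph w P) (hq : q ∈ wienerGraph w P) :
    inner ℝ p.2 q.2 = inner ℝ p.1 q.1 := by
  refine inner_snd_of_mem_closure_span (innerSL ℝ) ?_ hp hq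
  rintro ⟨h, X⟩ ⟨s, t, i, hst, hh, hX⟩ ⟨h', X'⟩ ⟨s', t', i', hst', hh', hX'⟩
  simp only at hh hX hh' hX'
  rw [innerSL_apply_apply, eq_stepVec hh, eq_stepVec hh', hw.inner_increments hst hst' i i' hX hX']

lemma norm_of_mem_wienerGraph (hw : IsBrownianMotion w P) {p : NoiseSpace d × Lp ℝ 2 P}
    (hp : p ∈ wienerGraph w P) : ‖p.2‖ = ‖p.1‖ := by
  have := hw.inner_of_mem_wienerGraph hp hp
  rw [real_inner_self_eq_norm_sq, real_inner_self_eq_norm_sq] at this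
  exact (sq_eq_sq₀ (norm_nonneg _) (norm_nonneg _)).1 this

omit [IsProbabilityMeasure P] in
lemma mem_wienerGraph_stepVec {s t : unitInterval} (hst : s ≤ t)
    (i : Fin d) {X : Lp ℝ 2 P} (hX : X =ᵐ[P] fun ω => w t ω i - w s ω i) :
    (stepVec i s t, X) ∈ wienerGraph w P := by
  exact Submodule.le_topologicalClosure _ (Submodule.subset_span
    ⟨s, t, i, hst, coeFn_stepVec i s t, hX⟩)

lemma exists_mem_wienerGraph (hw : IsBrownianMotion w P) (h : NoiseSpace d) :
    ∃ X, (h, X) ∈ wienerGraph w P := by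
  refine exists_mem_of_bounded_of_dense _ (Submodule.isClosed_topologicalClosure _) (C := 1)
    (fun p hp => by rw [hw.norm_of_mem_wienerGraph hp, one_mul]) ?_ h
  have h1 : Submodule.span ℝ {h : NoiseSpace d | ∃ s t i, s ≤ t ∧ h = stepVec i s t} ≤
      (wienerGraph w P).map (LinearMap.fst ℝ _ _) := by
    refine Submodule.span_le.2 ?_
    rintro h ⟨s, t, i, hst, rfl⟩
    have hm : MemLp (fun ω => w t ω i - w s ω i) 2 P :=
      (hw.memLp_coord t i).sub (hw.memLp_coord s i)
    exact ⟨(stepVec i s t, hm.toLp _), mem_wienerGraph_stepVec hst i hm.coeFn_toLp, rfl⟩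
  have h2 : Dense ((Submodule.span ℝ {h : NoiseSpace d | ∃ s t i, s ≤ t ∧ h = stepVec i s t} :
      Submodule ℝ (NoiseSpace d)) : Set (NoiseSpace d)) :=
    Submodule.dense_iff_topologicalClosure_eq_top.2 dense_span_stepVec
  exact h2.mono h1

lemma hasGaussianLaw_sum_coord (hw : IsBrownianMotion w P) {X : Lp ℝ 2 P}
    (hX : X ∈ Submodule.span ℝ (Set.range fun q : unitInterval × Fin d =>
      (hw.memLp_coord q.1 q.2).toLp (fun ω => w q.1 ω q.2))) :
    HasGaussianLaw (fun ω => X ω) P ∧ ∫ ω, X ω ∂P = 0 := by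
  obtain ⟨c, rfl⟩ := Finsupp.mem_span_range_iff_exists_finsupp.1 hX
  set b : unitInterval × Fin d → Lp ℝ 2 P := fun q => (hw.memLp_coord q.1 q.2).toLp _
  have h1 : ∀ᵐ ω ∂P, ∀ q ∈ c.support, (c q • b q : Lp ℝ 2 P) ω = c q * w q.1 ω q.2 := by
    refine (ae_ball_iff c.support.countable_toSet).2 fun q _ => ?_
    filter_upwards [Lp.coeFn_smul (c q) (b q), (hw.memLp_coord q.1 q.2).coeFn_toLp] with ω h1 h2
    rw [h1, Pi.smul_apply, h2, smul_eq_mul]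
  have h2 : (fun ω => ∑ q ∈ c.support, c q * w q.1 ω q.2) =ᵐ[P]
      fun ω => (c.sum fun q a => a • b q) ω := by
    filter_upwards [h1, Lp.coeFn_fun_finsetSum c.support fun q => c q • b q] with ω h1 h2
    rw [Finsupp.sum, h2]
    exact (Finset.sum_congr rfl h1).symm
  refine ⟨HasGaussianLaw.congr ?_ h2, ?_⟩
  · exact (hw.isGaussianProcess_coord.smul fun q => c q).hasGaussianLaw_fun_sum
  · rw [← integral_congr_ae h2, integral_finsetSum _ fun q _ =>
      ((hw.memLp_coord q.1 q.2).integrable (by norm_num)).const_mul _]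
    simp_rw [integral_const_mul, hw.integral_coord, mul_zero, Finset.sum_const_zero]

lemma hasGaussianLaw_of_mem_wienerGraph (hw : IsBrownianMotion w P)
    {p : NoiseSpace d × Lp ℝ 2 P} (hp : p ∈ wienerGraph w P) :
    HasGaussianLaw (fun ω => p.2 ω) P ∧ ∫ ω, p.2 ω ∂P = 0 := by
  set b : unitInterval × Fin d → Lp ℝ 2 P := fun q =>
    (hw.memLp_coord q.1 q.2).toLp (fun ω => w q.1 ω q.2) with hb
  have hcl : wienerGraph w P ≤ (Submodule.span ℝ (Set.range b)).topologicalClosure.comap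
      (LinearMap.snd ℝ _ _) := by
    refine Submodule.topologicalClosure_minimal _ (Submodule.span_le.2 ?_)
      ((Submodule.isClosed_topologicalClosure _).preimage continuous_snd)
    rintro ⟨h, X⟩ ⟨s, t, i, -, -, hX⟩
    have : X = b (t, i) - b (s, i) := by
      refine Lp.ext ?_
      filter_upwards [hX, Lp.coeFn_sub (b (t, i)) (b (s, i)), (hw.memLp_coord t i).coeFn_toLp,
        (hw.memLp_coord s i).coeFn_toLp] with ω h1 h2 h3 h4
      rw [h2, Pi.sub_apply, h1, ← h3, ← h4]
    change X ∈ (Submodule.span ℝ (Set.range b)).topologicalClosure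
    rw [this]
    exact Submodule.le_topologicalClosure _ (Submodule.sub_mem _ (Submodule.subset_span ⟨_, rfl⟩)
      (Submodule.subset_span ⟨_, rfl⟩))
  exact hasGaussianLaw_of_mem_closure (fun X hX => hw.hasGaussianLaw_sum_coord hX) (hcl hp)

/-- The Wiener integral is an isonormal Gaussian process defined on all of `L²([0,1], ℝ^d)`. -/
theorem exists_isIsonormal (hw : IsBrownianMotion w P) :
    ∃ W : NoiseSpace d →ₗᵢ[ℝ] Lp ℝ 2 P, IsIsonormal W ∧
      ∀ h X, IsWienerIntegral w P h X ↔ X = W h := by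
  obtain ⟨W, hW⟩ := exists_linearIsometry_of_norm_eq (wienerGraph w P)
    (fun p hp => hw.norm_of_mem_wienerGraph hp) hw.exists_mem_wienerGraph
  have hgauss : ∀ a, HasGaussianLaw (fun ω => W a ω) P ∧ ∫ ω, W a ω ∂P = 0 := fun a =>
    hw.hasGaussianLaw_of_mem_wienerGraph ((hW a _).2 rfl)
  exact ⟨W, ⟨isGaussianProcess_of_linearMap W.toLinearMap fun a => (hgauss a).1,
    fun a => (hgauss a).2⟩, hW⟩

end IsBrownianMotion

end Brownian

/-! ### Tensor products of elements of the noise space -/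

section Tensor

variable {d k : ℕ}

instance (d k : ℕ) : IsFiniteMeasure (kernelMeasure d k) := by
  unfold kernelMeasure; infer_instance

/-- The measure on `[0,1] × {1,…,d}` whose powers are the kernel measures. -/
noncomputable abbrev siteMeasure (d : ℕ) : Measure (unitInterval × Fin d) :=
  (volume : Measure unitInterval).prod Measure.count

/-- The element `h` of `L²([0,1], ℝ^d)` as the function `(t,i) ↦ h_i(t)`. -/
noncomputable def siteFun (h : NoiseSpace d) (q : unitInterval × Fin d) : ℝ := h q.1 q.2

lemma measurable_siteFun (h : NoiseSpace d) : Measurable (siteFun h) := by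
  refine measurable_from_prod_countable_left fun i => ?_
  have h1 : Measurable fun t => h t := (Lp.stronglyMeasurable h).measurable
  exact (EuclideanSpace.proj (𝕜 := ℝ) i : EuclideanSpace ℝ (Fin d) →L[ℝ] ℝ).measurable.comp h1

lemma integrable_coord_mul (a b : NoiseSpace d) (i : Fin d) :
    Integrable (fun t => a t i * b t i) := by
  have h : ∀ a : NoiseSpace d, MemLp (fun t => a t i) 2 := fun a =>
    (EuclideanSpace.proj (𝕜 := ℝ) i : EuclideanSpace ℝ (Fin d) →L[ℝ] ℝ).comp_memLp' (Lp.memLp a)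
  exact (h a).integrable_mul (h b)

lemma integrable_siteFun_mul (a b : NoiseSpace d) :
    Integrable (fun q => siteFun a q * siteFun b q) (siteMeasure d) := by
  have hm : AEStronglyMeasurable (fun q => siteFun a q * siteFun b q) (siteMeasure d) :=
    ((measurable_siteFun a).mul (measurable_siteFun b)).aestronglyMeasurable
  rw [integrable_prod_iff' hm]
  exact ⟨ae_of_all _ fun i => integrable_coord_mul a b i, by simp⟩

lemma integral_siteFun_mul (a b : NoiseSpace d) :
    ∫ q, siteFun a q * siteFun b q ∂siteMeasure d = inner ℝ a b := by
  rw [integral_prod_symm _ (integrable_siteFun_mul a b), integral_countable (by simp), tsum_fintype]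
  simp only [siteFun, measureReal_def, Measure.count_singleton, ENNReal.toReal_one, one_smul]
  rw [← integral_finsetSum _ fun i _ => integrable_coord_mul a b i, L2.inner_def]
  congr 1; ext t
  simp [PiLp.inner_apply, mul_comm]

lemma integrable_prod_siteFun_mul (a b : Fin k → NoiseSpace d) :
    Integrable (fun x => (∏ l, siteFun (a l) (x l)) * ∏ l, siteFun (b l) (x l))
      (kernelMeasure d k) := by
  simp_rw [← Finset.prod_mul_distrib]
  exact Integrable.fintype_prod fun l => integrable_siteFun_mul (a l) (b l)

lemma memLp_prod_siteFun (h : Fin k → NoiseSpace d) :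
    MemLp (fun x => ∏ l, siteFun (h l) (x l)) 2 (kernelMeasure d k) := by
  have hm : Measurable fun x : Fin k → unitInterval × Fin d => ∏ l, siteFun (h l) (x l) :=
    Finset.measurable_prod _ fun l _ => (measurable_siteFun (h l)).comp (measurable_pi_apply l)
  rw [memLp_two_iff_integrable_sq hm.aestronglyMeasurable]
  simp_rw [sq]
  exact integrable_prod_siteFun_mul h h

/-- The tensor product `h_1 ⊗ ⋯ ⊗ h_k`, as a kernel of order `k`. -/
noncomputable def tensor (h : Fin k → NoiseSpace d) : Kernel d k :=
  (memLp_prod_siteFun h).toLp _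

lemma coeFn_tensor (h : Fin k → NoiseSpace d) :
    tensor h =ᵐ[kernelMeasure d k] fun x => ∏ l, siteFun (h l) (x l) :=
  (memLp_prod_siteFun h).coeFn_toLp

lemma inner_tensor (a b : Fin k → NoiseSpace d) :
    inner ℝ (tensor a) (tensor b) = ∏ l, inner ℝ (a l) (b l) := by
  rw [L2.inner_def]
  calc ∫ x, inner ℝ (tensor a x) (tensor b x) ∂kernelMeasure d k
      = ∫ x, ∏ l, siteFun (a l) (x l) * siteFun (b l) (x l) ∂kernelMeasure d k := by
        refine integral_congr_ae ?_
        filter_upwards [coeFn_tensor a, coeFn_tensor b] with x h1 h2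
        rw [h1, h2, Finset.prod_mul_distrib]
        simp [mul_comm]
    _ = ∏ l, ∫ q, siteFun (a l) q * siteFun (b l) q ∂siteMeasure d :=
        integral_fintype_prod_eq_prod (μ := fun _ => siteMeasure d)
          fun l q => siteFun (a l) q * siteFun (b l) q
    _ = _ := by simp_rw [integral_siteFun_mul]

lemma norm_tensor (h : Fin k → NoiseSpace d) : ‖tensor h‖ = ∏ l, ‖h l‖ := by
  have h1 := inner_tensor h h
  simp_rw [real_inner_self_eq_norm_sq, Finset.prod_pow] at h1
  exact (sq_eq_sq₀ (norm_nonneg _) (Finset.prod_nonneg fun _ _ => norm_nonneg _)).1 h1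

lemma ae_siteFun_add (a b : NoiseSpace d) :
    ∀ᵐ q ∂siteMeasure d, siteFun (a + b) q = siteFun a q + siteFun b q := by
  have h := Lp.coeFn_add a b
  filter_upwards [Measure.quasiMeasurePreserving_fst.ae h] with q hq
  simp only [siteFun, hq, Pi.add_apply, PiLp.add_apply]

lemma ae_siteFun_smul (c : ℝ) (a : NoiseSpace d) :
    ∀ᵐ q ∂siteMeasure d, siteFun (c • a) q = c * siteFun a q := by
  have h := Lp.coeFn_smul c a
  filter_upwards [Measure.quasiMeasurePreserving_fst.ae h] with q hq
  simp only [siteFun, hq, Pi.smul_apply, PiLp.smul_apply, smul_eq_mul]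

lemma ae_kernelMeasure_eval (l : Fin k) {p : unitInterval × Fin d → Prop}
    (h : ∀ᵐ q ∂siteMeasure d, p q) : ∀ᵐ x ∂kernelMeasure d k, p (x l) :=
  (Measure.quasiMeasurePreserving_eval (μ := fun _ : Fin k => siteMeasure d) l).ae h

lemma prod_siteFun_update (h : Fin k → NoiseSpace d) (l : Fin k) (a : NoiseSpace d)
    (x : Fin k → unitInterval × Fin d) : ∏ m, siteFun (Function.update h l a m) (x m) =
      siteFun a (x l) * ∏ m ∈ Finset.univ.erase l, siteFun (h m) (x m) := by
  rw [← Finset.mul_prod_erase _ _ (Finset.mem_univ l), Function.update_self]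
  congr 1
  refine Finset.prod_congr rfl fun m hm => ?_
  rw [Function.update_of_ne (Finset.ne_of_mem_erase hm)]

/-- The tensor product as a continuous multilinear map. -/
noncomputable def tensorL (d k : ℕ) :
    ContinuousMultilinearMap ℝ (fun _ : Fin k => NoiseSpace d) (Kernel d k) :=
  MultilinearMap.mkContinuous
    (MultilinearMap.mk' tensor
      (fun h l a b => by
        refine Lp.ext ?_
        filter_upwards [coeFn_tensor (Function.update h l (a + b)),
          coeFn_tensor (Function.update h l a), coeFn_tensor (Function.update h l b),
          Lp.coeFn_add (tensor (Function.update h l a)) (tensor (Function.update h l b)),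
          ae_kernelMeasure_eval l (ae_siteFun_add a b)] with x h1 h2 h3 h4 h5
        rw [h1, h4, Pi.add_apply, h2, h3]
        simp only [prod_siteFun_update, h5]
        ring)
      (fun h l c a => by
        refine Lp.ext ?_
        filter_upwards [coeFn_tensor (Function.update h l (c • a)),
          coeFn_tensor (Function.update h l a), Lp.coeFn_smul c (tensor (Function.update h l a)),
          ae_kernelMeasure_eval l (ae_siteFun_smul c a)] with x h1 h2 h3 h4
        rw [h1, h3, Pi.smul_apply, h2]
        simp only [prod_siteFun_update, h4, smul_eq_mul]
        ring)) 1
    (fun h => by rw [one_mul]; exact (norm_tensor h).le)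

lemma tensorL_apply (h : Fin k → NoiseSpace d) : tensorL d k h = tensor h := rfl

/-! ### The action of permutations on kernels -/

/-- The kernel `x ↦ f (x ∘ σ)`. -/
noncomputable def permL (σ : Equiv.Perm (Fin k)) : Kernel d k →ₗᵢ[ℝ] Kernel d k :=
  Lp.compMeasurePreservingₗᵢ ℝ _ (measurePreserving_perm d k σ)

lemma coeFn_permL (σ : Equiv.Perm (Fin k)) (f : Kernel d k) :
    permL σ f =ᵐ[kernelMeasure d k] fun x => f (x ∘ σ) :=
  Lp.coeFn_compMeasurePreserving f (measurePreserving_perm d k σ)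

lemma mem_symmKernel_iff {f : Kernel d k} : f ∈ symmKernel d k ↔ ∀ σ, permL σ f = f := by
  refine forall_congr' fun σ => ⟨fun h => Lp.ext ((coeFn_permL σ f).trans h), fun h => ?_⟩
  have := coeFn_permL σ f
  rw [h] at this
  exact this.symm

lemma permL_tensor (σ : Equiv.Perm (Fin k)) (h : Fin k → NoiseSpace d) :
    permL σ (tensor h) = tensor fun l => h (σ.symm l) := by
  refine Lp.ext ?_
  filter_upwards [coeFn_permL σ (tensor h), coeFn_tensor fun l => h (σ.symm l),
    (measurePreserving_perm d k σ).quasiMeasurePreserving.ae (coeFn_tensor h)] with x h1 h2 h3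
  rw [h1, h2, h3, ← Equiv.prod_comp σ fun l => siteFun (h (σ.symm l)) (x l)]
  simp

lemma permL_mul (σ τ : Equiv.Perm (Fin k)) (f : Kernel d k) :
    permL σ (permL τ f) = permL (σ * τ) f := by
  refine Lp.ext ?_
  filter_upwards [coeFn_permL σ (permL τ f), coeFn_permL (σ * τ) f,
    (measurePreserving_perm d k σ).quasiMeasurePreserving.ae (coeFn_permL τ f)] with x h1 h2 h3
  rw [h1, h2, h3]
  rfl

lemma inner_permL (σ : Equiv.Perm (Fin k)) (f g : Kernel d k) :
    inner ℝ (permL σ f) g = inner ℝ f (permL σ⁻¹ g) := by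
  have h1 : permL (1 : Equiv.Perm (Fin k)) g = g := by
    refine Lp.ext ?_
    filter_upwards [coeFn_permL 1 g] with x hx
    rw [hx]; rfl
  rw [← (permL σ).inner_map_map f, permL_mul, mul_inv_cancel, h1]

/-- The sum of the images of a kernel under all permutations: `k!` times its symmetrisation. -/
noncomputable def sumPerm (d k : ℕ) : Kernel d k →L[ℝ] Kernel d k :=
  ∑ σ : Equiv.Perm (Fin k), (permL σ).toContinuousLinearMap

lemma sumPerm_apply (f : Kernel d k) : sumPerm d k f = ∑ σ : Equiv.Perm (Fin k), permL σ f := by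
  simp [sumPerm]

lemma sumPerm_mem_symmKernel (f : Kernel d k) : sumPerm d k f ∈ symmKernel d k := by
  rw [mem_symmKernel_iff]
  intro τ
  rw [sumPerm_apply, map_sum]
  simp_rw [permL_mul]
  exact Fintype.sum_equiv (Equiv.mulLeft τ) _ _ fun _ => rfl

lemma sumPerm_of_mem {f : Kernel d k} (hf : f ∈ symmKernel d k) :
    sumPerm d k f = (k.factorial : ℝ) • f := by
  rw [sumPerm_apply, Finset.sum_congr rfl fun σ _ => mem_symmKernel_iff.1 hf σ]
  simp [Fintype.card_perm, Nat.cast_smul_eq_nsmul]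

lemma norm_sumPerm_le (f : Kernel d k) : ‖sumPerm d k f‖ ≤ k.factorial * ‖f‖ := by
  rw [sumPerm_apply]
  refine (norm_sum_le _ _).trans ?_
  simp [Fintype.card_perm]

lemma inner_sumPerm (f g : Kernel d k) :
    inner ℝ (sumPerm d k f) g = inner ℝ f (sumPerm d k g) := by
  rw [sumPerm_apply, sumPerm_apply, sum_inner, inner_sum]
  simp_rw [inner_permL]
  exact Fintype.sum_equiv (Equiv.inv _) _ _ fun _ => rfl

lemma inner_tensor_of_mem {f : Kernel d k} (hf : f ∈ symmKernel d k) (σ : Equiv.Perm (Fin k))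
    (h : Fin k → NoiseSpace d) : inner ℝ f (tensor fun l => h (σ l)) = inner ℝ f (tensor h) := by
  have := permL_tensor σ⁻¹ h
  rw [show (fun l => h (σ l)) = fun l => h (σ⁻¹.symm l) from rfl, ← this, ← inner_permL,
    mem_symmKernel_iff.1 hf]

/-- A symmetric kernel orthogonal to all powers `h ⊗ ⋯ ⊗ h` is orthogonal to all tensor products:
differentiate the homogeneous polynomial `h ↦ ⟪f, h ⊗ ⋯ ⊗ h⟫`. -/
lemma inner_tensor_eq_zero_of_diagonal {f : Kernel d k} (hf : f ∈ symmKernel d k)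
    (h : ∀ u : NoiseSpace d, inner ℝ f (tensor fun _ => u) = 0) (v : Fin k → NoiseSpace d) :
    inner ℝ f (tensor v) = 0 := by
  let M := (innerSL ℝ f).compContinuousMultilinearMap (tensorL d k)
  have hM : ∀ v, M v = inner ℝ f (tensor v) := fun _ => rfl
  have h1 := M.iteratedFDeriv_comp_diagonal 0 v
  have h2 : (fun u => M fun _ => u) = fun _ => (0 : ℝ) := funext h
  rw [h2, iteratedFDeriv_fun_zero] at h1
  simp_rw [hM, inner_tensor_of_mem hf] at h1
  have h3 : (k.factorial : ℝ) * inner ℝ f (tensor v) = 0 := by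
    simpa [Fintype.card_perm] using h1.symm
  exact (mul_eq_zero.1 h3).resolve_left (by exact_mod_cast k.factorial_ne_zero)

end Tensor

/-! ### Step kernels vanishing on the diagonals are total -/

section Density

variable {d k : ℕ}

lemma measurableSet_cell (i : Fin d) (s t : unitInterval) : MeasurableSet (cell i s t) :=
  measurableSet_Ioc.prod (measurableSet_singleton i)

lemma ae_siteFun_stepVec (i : Fin d) (s t : unitInterval) :
    ∀ᵐ q ∂siteMeasure d, siteFun (stepVec i s t) q =
      (cell i s t).indicator (fun _ => (1 : ℝ)) q := by
  filter_upwards [Measure.quasiMeasurePreserving_fst.ae (coeFn_stepVec i s t)] with q hq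
  obtain ⟨x, j⟩ := q
  simp only at hq
  simp only [siteFun, hq]
  by_cases h : x ∈ Set.Ioc s t <;> by_cases hj : j = i <;>
    simp [cell, h, hj, Set.indicator]

/-- The box `∏ l, (s_l,t_l] × {i_l}`. -/
def box (i : Fin k → Fin d) (s t : Fin k → unitInterval) : Set (Fin k → unitInterval × Fin d) :=
  Set.univ.pi fun l => cell (i l) (s l) (t l)

lemma measurableSet_box (i : Fin k → Fin d) (s t : Fin k → unitInterval) :
    MeasurableSet (box i s t) :=
  MeasurableSet.univ_pi fun _ => measurableSet_cell _ _ _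

/-- The indicator function of a box, as a kernel. -/
noncomputable def stepKernel (i : Fin k → Fin d) (s t : Fin k → unitInterval) : Kernel d k :=
  tensor fun l => stepVec (i l) (s l) (t l)

lemma coeFn_stepKernel (i : Fin k → Fin d) (s t : Fin k → unitInterval) :
    stepKernel i s t =ᵐ[kernelMeasure d k] (box i s t).indicator fun _ => (1 : ℝ) := by
  have h : ∀ᵐ x ∂kernelMeasure d k, ∀ l, siteFun (stepVec (i l) (s l) (t l)) (x l) =
      (cell (i l) (s l) (t l)).indicator (fun _ => (1 : ℝ)) (x l) :=
    ae_all_iff.2 fun l => ae_kernelMeasure_eval l (ae_siteFun_stepVec _ _ _)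
  filter_upwards [coeFn_tensor fun l => stepVec (i l) (s l) (t l), h] with x h1 h2
  rw [stepKernel, h1, Finset.prod_congr rfl fun l _ => h2 l]
  by_cases hx : x ∈ box i s t
  · rw [Set.indicator_of_mem hx]
    exact Finset.prod_eq_one fun l _ => Set.indicator_of_mem (hx l (Set.mem_univ l)) _
  · rw [Set.indicator_of_notMem hx]
    simp only [box, Set.mem_univ_pi, not_forall] at hx
    obtain ⟨l, hl⟩ := hx
    exact Finset.prod_eq_zero (Finset.mem_univ l) (Set.indicator_of_notMem hl _)

lemma inner_stepKernel (i : Fin k → Fin d) (s t : Fin k → unitInterval) (f : Kernel d k) :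
    inner ℝ (stepKernel i s t) f = ∫ x in box i s t, f x ∂kernelMeasure d k := by
  rw [L2.inner_def, ← integral_indicator (measurableSet_box i s t)]
  refine integral_congr_ae ?_
  filter_upwards [coeFn_stepKernel i s t] with x hx
  rw [hx]
  by_cases h : x ∈ box i s t <;> simp [h]

/-- The vectors `s`, `t`, `i` define pairwise disjoint cells `(s_l,t_l] × {i_l}`. -/
def IsDisjointBox (i : Fin k → Fin d) (s t : Fin k → unitInterval) : Prop :=
  (∀ l, s l ≤ t l) ∧
    Pairwise fun l m => Disjoint (cell (i l) (s l) (t l)) (cell (i m) (s m) (t m))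

lemma isPiSystem_image2_Iic : IsPiSystem (Set.image2 (· ×ˢ ·)
    (Set.range (Set.Iic : unitInterval → _))
    {S : Set (Fin d) | MeasurableSet S}) :=
  isPiSystem_Iic.prod MeasurableSpace.isPiSystem_measurableSet

/-- A kernel orthogonal to the indicators of all products of disjoint cells vanishes on each such
box `B`: the sub-boxes of `B` have disjoint cells too, and they generate the `σ`-field on `B`. -/
lemma kernel_ae_eq_zero_on_box {f : Kernel d k} (hf : ∀ (i : Fin k → Fin d)
    (s t : Fin k → unitInterval), IsDisjointBox i s t → inner ℝ (stepKernel i s t) f = 0)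
    {i : Fin k → Fin d} {s t : Fin k → unitInterval} (hb : IsDisjointBox i s t) :
    f =ᵐ[(kernelMeasure d k).restrict (box i s t)] 0 := by
  have hint : ∀ i s t, IsDisjointBox i s t → ∫ x in box i s t, f x ∂kernelMeasure d k = 0 :=
    fun i s t h => (inner_stepKernel i s t f).symm.trans (hf i s t h)
  have hspan : IsCountablySpanning (Set.range (Set.Iic : unitInterval → Set unitInterval)) := by
    refine ⟨fun _ => Set.Iic 1, fun _ => ⟨1, rfl⟩, ?_⟩
    rw [Set.iUnion_const]
    ext x; simp [unitInterval.le_one']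
  have hgen : MeasurableSpace.generateFrom (Set.image2 (· ×ˢ ·)
      (Set.range (Set.Iic : unitInterval → _)) {S : Set (Fin d) | MeasurableSet S}) =
      (inferInstance : MeasurableSpace (unitInterval × Fin d)) :=
    generateFrom_eq_prod ((borel_eq_generateFrom_Iic unitInterval).symm.trans
      BorelSpace.measurable_eq.symm) MeasurableSpace.generateFrom_measurableSet hspan
      isCountablySpanning_measurableSet
  refine ae_eq_zero_of_setIntegral_piSystem
    (((Lp.memLp f).integrable (by norm_num)).integrableOn)
    (generateFrom_eq_pi (C := fun _ : Fin k => _) (fun _ => hgen)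
      fun _ => hspan.prod isCountablySpanning_measurableSet).symm
    (IsPiSystem.pi fun _ => isPiSystem_image2_Iic) (hint i s t hb) ?_
  rintro _ ⟨A, hA, rfl⟩
  have hA' : ∀ l, ∃ (u : unitInterval) (S : Set (Fin d)), Set.Iic u ×ˢ S = A l := by
    intro l
    obtain ⟨_, ⟨u, rfl⟩, S, -, h⟩ := hA l (Set.mem_univ l)
    exact ⟨u, S, h⟩
  choose u S hS using hA'
  classical
  -- The trace of the rectangle on the box is again a box, with smaller cells.
  let t' : Fin k → unitInterval := fun l => if i l ∈ S l then max (s l) (min (t l) (u l)) else s l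
  have ht' : ∀ l, t' l ≤ t l := by
    intro l
    simp only [t']
    split_ifs
    · exact max_le (hb.1 l) (min_le_left _ _)
    · exact hb.1 l
  have hs' : ∀ l, s l ≤ t' l := by
    intro l
    simp only [t']
    split_ifs
    · exact le_max_left _ _
    · exact le_rfl
  have hcell : ∀ l, A l ∩ cell (i l) (s l) (t l) = cell (i l) (s l) (t' l) := by
    intro l
    rw [← hS l]
    ext ⟨x, j⟩
    simp only [cell, Set.mem_inter_iff, Set.mem_prod, Set.mem_Iic, Set.mem_Ioc,
      Set.mem_singleton_iff, t']
    split_ifs with h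
    · constructor
      · rintro ⟨⟨h1, h2⟩, ⟨h3, h4⟩, h5⟩
        exact ⟨⟨h3, le_max_of_le_right (le_min h4 h1)⟩, h5⟩
      · rintro ⟨⟨h3, h4⟩, rfl⟩
        have h5 := (le_max_iff.1 h4).resolve_left (not_le.2 h3)
        exact ⟨⟨h5.trans (min_le_right _ _), h⟩, ⟨h3, h5.trans (min_le_left _ _)⟩, rfl⟩
    · constructor
      · rintro ⟨⟨h1, h2⟩, -, rfl⟩
        exact absurd h2 h
      · rintro ⟨⟨h3, h4⟩, rfl⟩
        exact absurd h4 (not_le.2 h3)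
  have hset : Set.univ.pi A ∩ box i s t = box i s t' := by
    rw [box, ← Set.pi_inter_distrib, box]
    exact Set.pi_congr rfl fun l _ => hcell l
  have hmA : MeasurableSet (Set.univ.pi A) := MeasurableSet.univ_pi fun l => by
    rw [← hS l]; exact measurableSet_Iic.prod (S l).toFinite.measurableSet
  rw [Measure.restrict_restrict hmA, hset]
  refine hint i s t' ⟨hs', fun l m hlm => (hb.2 hlm).mono ?_ ?_⟩
  · exact Set.prod_mono (Set.Ioc_subset_Ioc_right (ht' l)) subset_rfl
  · exact Set.prod_mono (Set.Ioc_subset_Ioc_right (ht' m)) subset_rfl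

lemma ae_fst_ne (l : Fin k) (c : unitInterval) : ∀ᵐ x ∂kernelMeasure d k, (x l).1 ≠ c := by
  refine ae_kernelMeasure_eval l (p := fun q => q.1 ≠ c) ?_
  have h : ∀ᵐ y : unitInterval, y ≠ c := by simp [ae_iff]
  exact Measure.quasiMeasurePreserving_fst.ae h

lemma ae_fst_ne_fst {l m : Fin k} (hlm : l ≠ m) :
    ∀ᵐ x ∂kernelMeasure d k, (x l).1 ≠ (x m).1 := by
  obtain ⟨n, rfl⟩ : ∃ n, k = n + 1 := ⟨k - 1, by have := l.pos; omega⟩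
  obtain ⟨m', rfl⟩ := Fin.exists_succAbove_eq hlm.symm
  have hmp := measurePreserving_piFinSuccAbove (fun _ : Fin (n + 1) => siteMeasure d) l
  have h : ∀ᵐ p ∂(siteMeasure d).prod (Measure.pi fun _ : Fin n => siteMeasure d),
      p.1.1 ≠ (p.2 m').1 := by
    have hm : MeasurableSet {p : (unitInterval × Fin d) × (Fin n → unitInterval × Fin d) |
        p.1.1 = (p.2 m').1} :=
      measurableSet_eq_fun (by fun_prop) (by fun_prop)
    rw [ae_iff]
    simp only [not_not]
    rw [Measure.measure_prod_null hm]
    refine ae_of_all _ fun y => ?_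
    have := ae_fst_ne (d := d) m' y.1
    rw [ae_iff] at this
    simp only [not_not] at this
    simpa [eq_comm, kernelMeasure] using this
  exact hmp.quasiMeasurePreserving.ae h

/-- A kernel orthogonal to the indicators of all products of disjoint cells vanishes: it vanishes on
each such box, and these boxes are neighbourhoods of almost all points. -/
lemma kernel_eq_zero_of_inner_stepKernel {f : Kernel d k} (hf : ∀ (i : Fin k → Fin d)
    (s t : Fin k → unitInterval), IsDisjointBox i s t → inner ℝ (stepKernel i s t) f = 0) :
    f = 0 := by
  rw [Lp.eq_zero_iff_ae_eq_zero]
  let G : Set (Fin k → unitInterval × Fin d) :=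
    {x | (∀ l m, l ≠ m → (x l).1 ≠ (x m).1) ∧ ∀ l, (x l).1 ≠ 0 ∧ (x l).1 ≠ 1}
  have hG : ∀ᵐ x ∂kernelMeasure d k, x ∈ G := by
    have h1 : ∀ᵐ x ∂kernelMeasure d k, ∀ l m, l ≠ m → (x l).1 ≠ (x m).1 :=
      ae_all_iff.2 fun l => ae_all_iff.2 fun m => ae_all_iff.2 fun h => ae_fst_ne_fst h
    have h2 : ∀ᵐ x ∂kernelMeasure d k, ∀ l, (x l).1 ≠ 0 ∧ (x l).1 ≠ 1 :=
      ae_all_iff.2 fun l => (ae_fst_ne l 0).and (ae_fst_ne l 1)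
    filter_upwards [h1, h2] with x h1 h2 using ⟨h1, h2⟩
  have hnull : kernelMeasure d k (G ∩ {x | f x ≠ 0}) = 0 := by
    refine measure_null_of_locally_null _ fun x hx => ?_
    obtain ⟨⟨hinj, h01⟩, -⟩ := hx
    obtain ⟨U, hU, hdisj⟩ := (Set.finite_range fun l => (x l).1).t2_separation
    have hI : ∀ l, ∃ s t : unitInterval, s ≤ t ∧ Set.Ioc s t ⊆ U (x l).1 ∧
        Set.Ioc s t ∈ 𝓝 (x l).1 := by
      intro l
      have hlo : ∃ a, a < (x l).1 := ⟨0, lt_of_le_of_ne unitInterval.nonneg' (h01 l).1.symm⟩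
      have hhi : ∃ b, (x l).1 < b := ⟨1, lt_of_le_of_ne unitInterval.le_one' (h01 l).2⟩
      obtain ⟨a, b, hab, hUab⟩ := (mem_nhds_iff_exists_Ioo_subset' hlo hhi).1
        ((hU (x l).1).2.mem_nhds (hU (x l).1).1)
      obtain ⟨c, hc1, hc2⟩ := exists_between hab.2
      exact ⟨a, c, (hab.1.trans hc1).le, fun y hy => hUab ⟨hy.1, hy.2.trans_lt hc2⟩,
        Ioc_mem_nhds hab.1 hc1⟩
    choose s t hst hsub hmem using hI
    let i : Fin k → Fin d := fun l => (x l).2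
    have hb : IsDisjointBox i s t := by
      refine ⟨hst, fun l m hlm => Set.disjoint_prod.2 (Or.inl ?_)⟩
      exact (hdisj ⟨l, rfl⟩ ⟨m, rfl⟩ (hinj l m hlm)).mono (hsub l) (hsub m)
    refine ⟨(G ∩ {x | f x ≠ 0}) ∩ box i s t,
      Filter.inter_mem self_mem_nhdsWithin (mem_nhdsWithin_of_mem_nhds ?_), ?_⟩
    · exact set_pi_mem_nhds Set.finite_univ fun l _ =>
        prod_mem_nhds (hmem l) ((isOpen_discrete _).mem_nhds rfl)
    · have h0 := (ae_restrict_iff' (measurableSet_box i s t)).1 (kernel_ae_eq_zero_on_box hf hb)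
      refine measure_mono_null ?_ h0
      rintro y ⟨⟨-, hy⟩, hyb⟩ h
      exact hy (h hyb)
  filter_upwards [hG, measure_eq_zero_iff_ae_notMem.1 hnull] with x h1 h2
  by_contra h
  exact h2 ⟨h1, h⟩

/-- The indicators of products of disjoint cells span a dense subspace of the space of kernels. -/
lemma dense_span_stepKernel : (Submodule.span ℝ {f : Kernel d k | ∃ i s t, IsDisjointBox i s t ∧
    f = stepKernel i s t}).topologicalClosure = ⊤ := by
  rw [Submodule.topologicalClosure_eq_top_iff, Submodule.eq_bot_iff]
  intro f hf
  exact kernel_eq_zero_of_inner_stepKernel fun i s t h =>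
    hf _ (Submodule.subset_span ⟨i, s, t, h, rfl⟩)

/-- A symmetric kernel is determined by its inner products with the powers `h ⊗ ⋯ ⊗ h`. -/
lemma symmKernel_eq_zero_of_diagonal {f : Kernel d k} (hf : f ∈ symmKernel d k)
    (h : ∀ u : NoiseSpace d, inner ℝ f (tensor fun _ => u) = 0) : f = 0 :=
  kernel_eq_zero_of_inner_stepKernel fun _ _ _ _ =>
    (real_inner_comm _ _).trans (inner_tensor_eq_zero_of_diagonal hf h _)

end Density

/-! ### Multiple Itô integrals: isometry, domain, and exponential vectors -/

/-- `W` is the Wiener integral `h ↦ ∫₀¹ h(t) · dw(t)` with respect to the Brownian motion `w`. -/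
structure IsWienerMap {Ω : Type*} [MeasurableSpace Ω] {P : Measure Ω} {d : ℕ}
    (w : unitInterval → Ω → EuclideanSpace ℝ (Fin d)) (W : NoiseSpace d →ₗᵢ[ℝ] Lp ℝ 2 P) : Prop
    extends IsIsonormal W where
  brownian : IsBrownianMotion w P
  isWienerIntegral_iff : ∀ h X, IsWienerIntegral w P h X ↔ X = W h

section MultipleIntegral

variable {Ω : Type*} [MeasurableSpace Ω] {P : Measure Ω} [IsProbabilityMeasure P] {d k : ℕ}
  {w : unitInterval → Ω → EuclideanSpace ℝ (Fin d)} {W : NoiseSpace d →ₗᵢ[ℝ] Lp ℝ 2 P}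

lemma inner_stepVec_eq_zero {i : Fin k → Fin d} {s t : Fin k → unitInterval}
    (h : IsDisjointBox i s t) :
    Pairwise fun l m => inner ℝ (stepVec (i l) (s l) (t l)) (stepVec (i m) (s m) (t m)) = 0 := by
  intro l m hlm
  rw [inner_stepVec_stepVec]
  split_ifs with hi
  · have hd := h.2 hlm
    have hd' : Disjoint (Set.Ioc (s l) (t l)) (Set.Ioc (s m) (t m)) :=
      (Set.disjoint_prod.1 hd).resolve_right (by simp [hi])
    rw [Set.disjoint_iff_inter_eq_empty, Set.Ioc_inter_Ioc, Set.Ioc_eq_empty_iff, not_lt] at hd'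
    refine max_eq_right (sub_nonpos.2 ?_)
    simpa [← Subtype.coe_le_coe] using hd'
  · rfl

omit [IsProbabilityMeasure P] in
lemma ae_eq_stepVec (hW : IsWienerMap w W) {s t : unitInterval}
    (hst : s ≤ t) (i : Fin d) : ∀ᵐ ω ∂P, W (stepVec i s t) ω = w t ω i - w s ω i := by
  have hm : MemLp (fun ω => w t ω i - w s ω i) 2 P :=
    (hW.brownian.memLp_coord t i).sub (hW.brownian.memLp_coord s i)
  have h := (hW.isWienerIntegral_iff _ _).1
    (IsBrownianMotion.mem_wienerGraph_stepVec hst i hm.coeFn_toLp)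
  rw [← h]
  exact hm.coeFn_toLp

omit [IsProbabilityMeasure P] in
/-- An elementary pair consists of `h_1 ⊗ ⋯ ⊗ h_k` and `∏ l, W h_l`, where the `h_l` are
indicators of disjoint cells. -/
lemma exists_of_mem_elementaryPairs (hW : IsWienerMap w W)
    {p : Kernel d k × Lp ℝ 2 P} (hp : p ∈ elementaryPairs w P k) :
    ∃ a : Fin k → NoiseSpace d, (Pairwise fun l m => inner ℝ (a l) (a m) = 0) ∧ p.1 = tensor a ∧
      p.2 =ᵐ[P] fun ω => ∏ l, W (a l) ω := by
  obtain ⟨i, s, t, hst, hd, h1, h2⟩ := hp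
  refine ⟨fun l => stepVec (i l) (s l) (t l), inner_stepVec_eq_zero ⟨hst, hd⟩,
    Lp.ext (h1.trans (coeFn_stepKernel i s t).symm), ?_⟩
  filter_upwards [h2, ae_all_iff.2 fun l => ae_eq_stepVec hW (hst l) (i l)] with ω h3 h4
  rw [h3]
  exact Finset.prod_congr rfl fun l _ => (h4 l).symm

lemma exists_mem_multipleIntegralGraph_stepKernel (hW : IsWienerMap w W)
    {i : Fin k → Fin d} {s t : Fin k → unitInterval} (h : IsDisjointBox i s t) :
    ∃ X, (stepKernel i s t, X) ∈ multipleIntegralGraph w P k := by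
  have hm := (HasAllMoments.prod Finset.univ
    fun l => hW.hasAllMoments (stepVec (i l) (s l) (t l))).memLp_two
  refine ⟨hm.toLp _, Submodule.le_topologicalClosure _ (Submodule.subset_span
    ⟨i, s, t, h.1, h.2, coeFn_stepKernel i s t, ?_⟩)⟩
  filter_upwards [hm.coeFn_toLp, ae_all_iff.2 fun l => ae_eq_stepVec hW (h.1 l) (i l)]
    with ω h3 h4
  rw [h3]
  exact Finset.prod_congr rfl fun l _ => h4 l

lemma inner_of_mem_elementaryPairs (hW : IsWienerMap w W) {p q : Kernel d k × Lp ℝ 2 P}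
    (hp : p ∈ elementaryPairs w P k) (hq : q ∈ elementaryPairs w P k) :
    inner ℝ p.2 q.2 = inner ℝ (sumPerm d k p.1) q.1 := by
  obtain ⟨a, ha, hp1, hp2⟩ := exists_of_mem_elementaryPairs hW hp
  obtain ⟨b, hb, hq1, hq2⟩ := exists_of_mem_elementaryPairs hW hq
  have h1 : inner ℝ p.2 q.2 = ∫ ω, (∏ l, W (a l) ω) * ∏ l, W (b l) ω ∂P := by
    rw [L2.inner_def]
    refine integral_congr_ae ?_
    filter_upwards [hp2, hq2] with ω h1 h2
    rw [h1, h2]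
    exact mul_comm _ _
  rw [h1, hW.integral_prod_mul_prod a b ha hb, hp1, hq1, sumPerm_apply, sum_inner]
  refine Finset.sum_congr rfl fun σ _ => ?_
  rw [permL_tensor, inner_tensor, ← Equiv.prod_comp σ fun l => inner ℝ (a (σ.symm l)) (b l)]
  simp only [Equiv.symm_apply_apply]

/-- The Itô isometry for multiple integrals of arbitrary, not necessarily symmetric, kernels. -/
lemma inner_of_isMultipleIntegral (hW : IsWienerMap w W) {f g : Kernel d k} {X Y : Lp ℝ 2 P}
    (hX : IsMultipleIntegral w P k f X) (hY : IsMultipleIntegral w P k g Y) :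
    inner ℝ X Y = inner ℝ (sumPerm d k f) g :=
  inner_snd_of_mem_closure_span (A := elementaryPairs w P k)
    ((innerSL ℝ).comp (sumPerm d k))
    (fun _ hp _ hq => inner_of_mem_elementaryPairs hW hp hq) hX hY

/-- The Itô isometry for multiple integrals of symmetric kernels. -/
lemma norm_sq_of_isMultipleIntegral (hW : IsWienerMap w W) {f : Kernel d k} {X : Lp ℝ 2 P}
    (hf : f ∈ symmKernel d k) (hX : IsMultipleIntegral w P k f X) :
    ‖X‖ ^ 2 = k.factorial * ‖f‖ ^ 2 := by
  have := inner_of_isMultipleIntegral hW hX hX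
  rwa [sumPerm_of_mem hf, real_inner_smul_left, real_inner_self_eq_norm_sq,
    real_inner_self_eq_norm_sq] at this

omit [IsProbabilityMeasure P] in
lemma IsMultipleIntegral.sub {f g : Kernel d k} {X Y : Lp ℝ 2 P}
    (hX : IsMultipleIntegral w P k f X) (hY : IsMultipleIntegral w P k g Y) :
    IsMultipleIntegral w P k (f - g) (X - Y) :=
  (multipleIntegralGraph w P k).sub_mem hX hY

lemma norm_le_of_isMultipleIntegral (hW : IsWienerMap w W) {f : Kernel d k} {X : Lp ℝ 2 P}
    (hX : IsMultipleIntegral w P k f X) : ‖X‖ ≤ k.factorial * ‖f‖ := by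
  have h1 := inner_of_isMultipleIntegral hW hX hX
  rw [real_inner_self_eq_norm_sq] at h1
  have h2 : ‖X‖ ^ 2 ≤ k.factorial * ‖f‖ * ‖f‖ := by
    rw [h1]
    exact (real_inner_le_norm _ _).trans
      (mul_le_mul_of_nonneg_right (norm_sumPerm_le f) (norm_nonneg f))
  have h3 : (1 : ℝ) ≤ k.factorial := by exact_mod_cast k.factorial_pos
  refine le_of_sq_le_sq ?_ (by positivity)
  nlinarith [mul_nonneg (norm_nonneg f) (norm_nonneg f)]

/-- Multiple integrals are well defined. -/
lemma IsMultipleIntegral.unique (hW : IsWienerMap w W) {f : Kernel d k} {X Y : Lp ℝ 2 P}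
    (hX : IsMultipleIntegral w P k f X) (hY : IsMultipleIntegral w P k f Y) : X = Y := by
  have := norm_le_of_isMultipleIntegral hW (hX.sub hY)
  rw [sub_self, norm_zero, mul_zero] at this
  exact sub_eq_zero.1 (norm_le_zero_iff.1 this)

/-- A multiple integral determines its symmetric kernel. -/
lemma IsMultipleIntegral.kernel_unique (hW : IsWienerMap w W) {f g : Kernel d k} {X : Lp ℝ 2 P}
    (hf : f ∈ symmKernel d k) (hg : g ∈ symmKernel d k)
    (hX : IsMultipleIntegral w P k f X) (hY : IsMultipleIntegral w P k g X) : f = g := by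
  have := norm_sq_of_isMultipleIntegral hW ((symmKernel d k).sub_mem hf hg) (hX.sub hY)
  rw [sub_self, norm_zero, zero_pow two_ne_zero, zero_eq_mul] at this
  have h2 := this.resolve_left (by exact_mod_cast k.factorial_ne_zero)
  exact sub_eq_zero.1 (norm_eq_zero.1 (pow_eq_zero_iff two_ne_zero |>.1 h2))

/-- Every square integrable kernel has a multiple integral. -/
lemma exists_isMultipleIntegral (hW : IsWienerMap w W) (f : Kernel d k) :
    ∃ X, IsMultipleIntegral w P k f X := by
  refine exists_mem_of_bounded_of_dense (multipleIntegralGraph w P k)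
    (Submodule.isClosed_topologicalClosure _) (C := k.factorial)
    (fun p hp => norm_le_of_isMultipleIntegral hW hp) ?_ f
  have h1 : Submodule.span ℝ {f : Kernel d k | ∃ i s t, IsDisjointBox i s t ∧
      f = stepKernel i s t} ≤ (multipleIntegralGraph w P k).map (LinearMap.fst ℝ _ _) := by
    refine Submodule.span_le.2 ?_
    rintro _ ⟨i, s, t, h, rfl⟩
    obtain ⟨X, hX⟩ := exists_mem_multipleIntegralGraph_stepKernel hW h
    exact ⟨_, hX, rfl⟩
  exact Dense.mono h1 (Submodule.dense_iff_topologicalClosure_eq_top.2 dense_span_stepKernel)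

/-- The exponential vector `exp (W h - ‖h‖² / 2)`. -/
noncomputable def expVec (hW : IsIsonormal W) (h : NoiseSpace d) : Lp ℝ 2 P :=
  ((hW.hasAllMoments_exp h).const_mul (rexp (-‖h‖ ^ 2 / 2))).memLp_two.toLp _

omit [IsProbabilityMeasure P] in
lemma coeFn_expVec (hW : IsIsonormal W) (h : NoiseSpace d) :
    expVec hW h =ᵐ[P] fun ω => rexp (-‖h‖ ^ 2 / 2) * rexp (W h ω) :=
  MemLp.coeFn_toLp _

/-- The pairing of a multiple integral with exponential vectors (its `S`-transform). -/
lemma inner_expVec (hW : IsWienerMap w W)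
    {f : Kernel d k} {X : Lp ℝ 2 P} (hX : IsMultipleIntegral w P k f X) (h : NoiseSpace d) :
    inner ℝ (expVec hW.toIsIsonormal h) X = inner ℝ f (tensor fun _ => h) := by
  rw [real_inner_comm _ f]
  refine eq_of_mem_closure_span (A := elementaryPairs w P k)
    (L := (innerSL ℝ (expVec hW.toIsIsonormal h)).comp (ContinuousLinearMap.snd ℝ _ _))
    (M := (innerSL ℝ (tensor fun _ => h)).comp (ContinuousLinearMap.fst ℝ _ _)) ?_ hX
  intro p hp
  obtain ⟨a, ha, hp1, hp2⟩ := exists_of_mem_elementaryPairs hW hp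
  have h1 : inner ℝ (expVec hW.toIsIsonormal h) p.2 =
      ∫ ω, rexp (-‖h‖ ^ 2 / 2) * ((∏ l, W (a l) ω) * rexp (W h ω)) ∂P := by
    rw [L2.inner_def]
    refine integral_congr_ae ?_
    filter_upwards [hp2, coeFn_expVec hW.toIsIsonormal h] with ω h1 h2
    rw [h1, h2]
    simp only [RCLike.inner_apply, conj_trivial]
    ring
  change inner ℝ (expVec hW.toIsIsonormal h) p.2 = inner ℝ (tensor fun _ => h) p.1
  rw [h1, integral_const_mul, hW.integral_prod_mul_exp Finset.univ a ha h, hp1, inner_tensor,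
    mul_left_comm, ← Real.exp_add, show -‖h‖ ^ 2 / 2 + ‖h‖ ^ 2 / 2 = 0 by ring, Real.exp_zero,
    mul_one]
  exact Finset.prod_congr rfl fun l _ => real_inner_comm _ _

end MultipleIntegral

/-! ### Kernels of measurable generalised functions -/

section Measurability

variable {Ω : Type*} [m0 : MeasurableSpace Ω] {P : Measure Ω} [IsProbabilityMeasure P] {d k : ℕ}
  {w : unitInterval → Ω → EuclideanSpace ℝ (Fin d)} {W : NoiseSpace d →ₗᵢ[ℝ] Lp ℝ 2 P}

omit [IsProbabilityMeasure P] in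
lemma noiseSigma_le_comap (hW : IsWienerMap w W) (H : Submodule ℝ (NoiseSpace d)) :
    noiseSigma w P H ≤ MeasurableSpace.comap
      (fun ω (a : (H : Set (NoiseSpace d))) => W a ω) MeasurableSpace.pi := by
  refine iSup₂_le ?_
  rintro X ⟨h, hh, hX⟩
  rw [(hW.isWienerIntegral_iff h X).1 hX]
  have h1 : Measurable fun y : ↥(H : Set (NoiseSpace d)) → ℝ => y ⟨h, hh⟩ := measurable_pi_apply _
  have h2 := h1.comp
    (comap_measurable (m := MeasurableSpace.pi) fun ω (a : ↥(H : Set (NoiseSpace d))) => W a ω)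
  rw [← BorelSpace.measurable_eq (α := ℝ)]
  exact h2.comap_le

omit [IsProbabilityMeasure P] in
lemma measurable_noiseSigma (hW : IsWienerMap w W) {H : Submodule ℝ (NoiseSpace d)}
    {u : NoiseSpace d} (hu : u ∈ H) : Measurable[noiseSigma w P H] fun ω => W u ω := by
  rw [measurable_iff_comap_le, BorelSpace.measurable_eq (α := ℝ)]
  exact le_iSup₂_of_le (W u) ⟨u, hu, (hW.isWienerIntegral_iff _ _).2 rfl⟩ le_rfl

/-- The exponential of a Wiener integral orthogonal to `H` is independent of `σ(H)`, so that it
drops out of the pairing with `σ(H)`-measurable variables. -/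
lemma inner_expVec_add (hW : IsWienerMap w W) {H : Submodule ℝ (NoiseSpace d)}
    {u v : NoiseSpace d} (hu : u ∈ H) (hv : v ∈ Hᗮ) {X : Lp ℝ 2 P}
    (hX : AEStronglyMeasurable[noiseSigma w P H] (fun ω => X ω) P) :
    inner ℝ (expVec hW.toIsIsonormal (u + v)) X = inner ℝ (expVec hW.toIsIsonormal u) X := by
  obtain ⟨X', hX'm, hXX'⟩ := hX
  have hle : noiseSigma w P H ≤ m0 := (noiseSigma_le_comap hW H).trans
    (measurable_pi_lambda _ fun a : ↥(H : Set (NoiseSpace d)) =>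
      (Lp.stronglyMeasurable (W a)).measurable).comap_le
  have hFm : Measurable[noiseSigma w P H] fun ω => X' ω * rexp (W u ω) :=
    hX'm.measurable.mul (measurable_exp.comp (measurable_noiseSigma hW hu))
  have hind : IndepFun (fun ω => X' ω * rexp (W u ω)) (fun ω => rexp (W v ω)) P := by
    have h1 := hW.indepFun (H : Set (NoiseSpace d)) {v} fun a ha b hb => by
      rw [Set.mem_singleton_iff.1 hb]; exact hv a ha
    have h2 := h1.comp measurable_id
      (measurable_pi_apply (⟨v, rfl⟩ : ({v} : Set (NoiseSpace d))))
    rw [IndepFun_iff_Indep] at h2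
    have h3 : IndepFun (fun ω => X' ω * rexp (W u ω)) (fun ω => W v ω) P := by
      rw [IndepFun_iff_Indep]
      exact indep_of_indep_of_le_left h2
        ((measurable_iff_comap_le.1 hFm).trans (noiseSigma_le_comap hW H))
    exact h3.comp measurable_id measurable_exp
  have hmul := hind.integral_fun_mul_eq_mul_integral
    (hFm.mono hle le_rfl).aestronglyMeasurable (hW.hasAllMoments_exp v).memLp_two.1
  rw [hW.integral_exp] at hmul
  have hnorm : ‖u + v‖ ^ 2 = ‖u‖ ^ 2 + ‖v‖ ^ 2 := by
    rw [norm_add_sq_real, hv u hu]; ring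
  have hL : inner ℝ (expVec hW.toIsIsonormal (u + v)) X =
      ∫ ω, rexp (-‖u + v‖ ^ 2 / 2) * (X' ω * rexp (W u ω) * rexp (W v ω)) ∂P := by
    rw [L2.inner_def]
    refine integral_congr_ae ?_
    filter_upwards [hXX', coeFn_expVec hW.toIsIsonormal (u + v), IsIsonormal.coeFn_add W u v]
      with ω h1 h2 h3
    rw [h1, h2, h3, Real.exp_add]
    simp only [RCLike.inner_apply, conj_trivial]
    ring
  have hR : inner ℝ (expVec hW.toIsIsonormal u) X =
      ∫ ω, rexp (-‖u‖ ^ 2 / 2) * (X' ω * rexp (W u ω)) ∂P := by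
    rw [L2.inner_def]
    refine integral_congr_ae ?_
    filter_upwards [hXX', coeFn_expVec hW.toIsIsonormal u] with ω h1 h2
    rw [h1, h2]
    simp only [RCLike.inner_apply, conj_trivial]
    ring
  have hexp : rexp (-‖u + v‖ ^ 2 / 2) * rexp (‖v‖ ^ 2 / 2) = rexp (-‖u‖ ^ 2 / 2) := by
    rw [← Real.exp_add, hnorm]
    congr 1
    ring
  rw [hL, hR, integral_const_mul, integral_const_mul, hmul, ← hexp]
  ring

lemma tensor_smul_const (t : ℝ) (h : NoiseSpace d) :
    tensor (fun _ : Fin k => t • h) = t ^ k • tensor fun _ => h := by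
  have := (tensorL d k).map_smul_univ (fun _ => t) (fun _ => h)
  simpa [tensorL_apply] using this

/-- The pairing of a square integrable variable with the exponential vectors of the multiples of `h`
is a power series, whose coefficients are the values of the kernels on the powers of `h`. -/
lemma hasSum_inner_expVec (hW : IsWienerMap w W) {ζ : FormalSeries w P} {X : Lp ℝ 2 P}
    (hζ : IsExpansion w P ζ X) {f : (k : ℕ) → Kernel d k}
    (hf : ∀ k, IsMultipleIntegral w P k (f k) (ζ k)) (h : NoiseSpace d) (t : ℝ) :
    HasSum (fun k => t ^ k * inner ℝ (f k) (tensor fun _ => h))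
      (inner ℝ (expVec hW.toIsIsonormal (t • h)) X) := by
  have h1 := (innerSL ℝ (expVec hW.toIsIsonormal (t • h))).hasSum hζ
  convert! h1 using 2 with k
  rw [innerSL_apply_apply, inner_expVec hW (hf k), tensor_smul_const,
    inner_smul_right]

/-- A power series with sum zero on the whole line has vanishing coefficients. -/
lemma eq_zero_of_hasSum_pow {c : ℕ → ℝ} (h : ∀ t : ℝ, HasSum (fun k => t ^ k * c k) 0) :
    c = 0 := by
  have h1 : HasFPowerSeriesAt (0 : ℝ → ℝ) (FormalMultilinearSeries.ofScalars ℝ c) 0 := by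
    rw [hasFPowerSeriesAt_iff]
    refine Eventually.of_forall fun t => ?_
    simpa [FormalMultilinearSeries.coeff_ofScalars] using h t
  have h2 := h1.eq_zero
  funext k
  have := congrArg (fun p => FormalMultilinearSeries.coeff p k) h2
  simp only [FormalMultilinearSeries.coeff_ofScalars] at this
  rw [this]
  rfl

/-- The kernels of a `σ(H)`-measurable variable do not see directions orthogonal to `H`. -/
lemma inner_tensor_add_of_measurable (hW : IsWienerMap w W) {H : Submodule ℝ (NoiseSpace d)}
    {ζ : FormalSeries w P} {X : Lp ℝ 2 P} (hζ : IsExpansion w P ζ X)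
    (hX : AEStronglyMeasurable[noiseSigma w P H] (fun ω => X ω) P) {f : (k : ℕ) → Kernel d k}
    (hf : ∀ k, IsMultipleIntegral w P k (f k) (ζ k)) {u v : NoiseSpace d} (hu : u ∈ H)
    (hv : v ∈ Hᗮ) (k : ℕ) :
    inner ℝ (f k) (tensor fun _ => u + v) = inner ℝ (f k) (tensor fun _ => u) := by
  have h : ∀ t : ℝ, HasSum (fun k => t ^ k * (inner ℝ (f k) (tensor fun _ => u + v) -
      inner ℝ (f k) (tensor fun _ => u))) 0 := by
    intro t
    have h1 := (hasSum_inner_expVec hW hζ hf (u + v) t).sub (hasSum_inner_expVec hW hζ hf u t)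
    rw [smul_add, inner_expVec_add hW (H.smul_mem t hu) (Hᗮ.smul_mem t hv) hX, sub_self] at h1
    simpa only [mul_sub] using h1
  exact sub_eq_zero.1 (congrFun (eq_zero_of_hasSum_pow h) k)

/-- The closed span of the powers `u ⊗ ⋯ ⊗ u`, `u ∈ H`: the `k`-fold symmetric tensor power
of `H`. -/
noncomputable def symmPower (H : Submodule ℝ (NoiseSpace d)) (k : ℕ) : Submodule ℝ (Kernel d k) :=
  (Submodule.span ℝ {f | ∃ u ∈ H, f = tensor fun _ => u}).topologicalClosure

lemma isClosed_symmPower (H : Submodule ℝ (NoiseSpace d)) (k : ℕ) :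
    IsClosed (symmPower H k : Set (Kernel d k)) := Submodule.isClosed_topologicalClosure _

lemma tensor_mem_symmPower {H : Submodule ℝ (NoiseSpace d)} {u : NoiseSpace d} (hu : u ∈ H) :
    (tensor fun _ : Fin k => u) ∈ symmPower H k :=
  Submodule.le_topologicalClosure _ (Submodule.subset_span ⟨u, hu, rfl⟩)

lemma symmPower_le_symmKernel (H : Submodule ℝ (NoiseSpace d)) :
    symmPower H k ≤ symmKernel d k := by
  intro f hf
  rw [mem_symmKernel_iff]
  intro σ
  refine eq_of_mem_closure_span (L := (permL σ).toContinuousLinearMap)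
    (M := ContinuousLinearMap.id ℝ _) ?_ hf
  rintro _ ⟨u, -, rfl⟩
  exact permL_tensor σ _

lemma inner_tensor_add_of_mem_symmPower {H : Submodule ℝ (NoiseSpace d)} {f : Kernel d k}
    (hf : f ∈ symmPower H k) {v : NoiseSpace d} (u : NoiseSpace d) (hv : v ∈ Hᗮ) :
    inner ℝ f (tensor fun _ => u + v) = inner ℝ f (tensor fun _ => u) := by
  rw [real_inner_comm _ f, real_inner_comm _ f]
  refine eq_of_mem_closure_span (L := innerSL ℝ (tensor fun _ => u + v))
    (M := innerSL ℝ (tensor fun _ => u)) ?_ hf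
  rintro _ ⟨u', hu', rfl⟩
  have h0 : inner ℝ v u' = 0 := (real_inner_comm _ _).trans (hv u' hu')
  simp only [innerSL_apply_apply, inner_tensor, inner_add_left, h0, add_zero]

/-- The component of `f` orthogonal to the symmetric power of `H` vanishes on the powers of `u + v`,
`u ∈ H`, `v ⟂ H`, hence on a dense set of powers. -/
lemma mem_symmPower_of_inner_tensor_add {H : Submodule ℝ (NoiseSpace d)} {f : Kernel d k}
    (hf : f ∈ symmKernel d k) (h : ∀ u ∈ H, ∀ v ∈ Hᗮ,
      inner ℝ f (tensor fun _ => u + v) = inner ℝ f (tensor fun _ => u)) : f ∈ symmPower H k := by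
  have : CompleteSpace (symmPower H k) := (isClosed_symmPower H k).completeSpace_coe
  obtain ⟨f₀, hf₀, f₁, hf₁, rfl⟩ := (symmPower H k).exists_add_mem_mem_orthogonal f
  have hs : f₁ ∈ symmKernel d k := by
    have := (symmKernel d k).sub_mem hf (symmPower_le_symmKernel H hf₀)
    rwa [add_sub_cancel_left] at this
  have h1 : ∀ u ∈ H, ∀ v ∈ Hᗮ, inner ℝ f₁ (tensor fun _ => u + v) = 0 := by
    intro u hu v hv
    have h2 := h u hu v hv
    rw [inner_add_left, inner_add_left, inner_tensor_add_of_mem_symmPower hf₀ u hv,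
      add_right_inj] at h2
    rw [h2, real_inner_comm]
    exact hf₁ _ (tensor_mem_symmPower hu)
  have hcont : Continuous fun u : NoiseSpace d => inner ℝ f₁ (tensor fun _ => u) := by
    have hc : Continuous fun u : NoiseSpace d => tensorL d k fun _ => u :=
      (tensorL d k).cont.comp (continuous_pi fun _ => continuous_id)
    exact continuous_const.inner hc
  have h0 : f₁ = 0 := by
    refine symmKernel_eq_zero_of_diagonal hs fun x => ?_
    obtain ⟨u, hu, v, hv, rfl⟩ := H.topologicalClosure.exists_add_mem_mem_orthogonal x
    rw [Submodule.orthogonal_closure] at hv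
    have hcl : IsClosed {u | inner ℝ f₁ (tensor fun _ => u + v) = 0} :=
      isClosed_eq (hcont.comp (continuous_id.add continuous_const)) continuous_const
    exact closure_minimal (fun u hu => h1 u hu v hv) hcl hu
  rw [h0, add_zero]
  exact hf₀

/-- The kernels of a `σ(H)`-measurable generalised function lie in the symmetric tensor powers
of `H`: convergence in `𝔻^{2,γ}` implies `L²`-convergence of the kernels of each order. -/
lemma mem_symmPower_of_isMeasurableWrt (hW : IsWienerMap w W) {H : Submodule ℝ (NoiseSpace d)}
    {γ : ℝ} {η : FormalSeries w P} (hη : η ∈ sobolevSpace w P γ)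
    (hm : IsMeasurableWrt (noiseSigma w P H) w P γ η) {f : Kernel d k}
    (hf : f ∈ symmKernel d k) (hfη : IsMultipleIntegral w P k f (η k)) : f ∈ symmPower H k := by
  rw [← SetLike.mem_coe, ← (isClosed_symmPower H k).closure_eq, Metric.mem_closure_iff]
  intro ε hε
  have hpos : (0 : ℝ) < ((k : ℝ) + 1) ^ γ := by positivity
  obtain ⟨ζ, hζ, hlt, X, hXm, hX⟩ := hm (ε * √(((k : ℝ) + 1) ^ γ)) (by positivity)
  choose g hgs hg using fun j => (mem_chaos_iff w P j (ζ j)).1 (ζ j).2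
  refine ⟨g k, mem_symmPower_of_inner_tensor_add (hgs k) fun u hu v hv =>
    inner_tensor_add_of_measurable hW hX hXm hg hu hv k, ?_⟩
  have hsum : Summable fun j : ℕ => ((j : ℝ) + 1) ^ γ * ‖(η - ζ) j‖ ^ 2 :=
    (sobolevSpace w P γ).sub_mem hη hζ
  have h1 : ((k : ℝ) + 1) ^ γ * ‖(η - ζ) k‖ ^ 2 < ε ^ 2 * ((k : ℝ) + 1) ^ γ := by
    calc _ ≤ ∑' j : ℕ, ((j : ℝ) + 1) ^ γ * ‖(η - ζ) j‖ ^ 2 :=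
          hsum.le_tsum k fun j _ => by positivity
      _ < (ε * √(((k : ℝ) + 1) ^ γ)) ^ 2 :=
          (Real.sqrt_lt' (by positivity)).1 hlt
      _ = _ := by rw [mul_pow, Real.sq_sqrt hpos.le]
  have h2 : ‖(η - ζ) k‖ ^ 2 < ε ^ 2 := by
    rw [mul_comm] at h1
    exact lt_of_mul_lt_mul_right h1 hpos.le
  have h3 : ‖(η - ζ) k‖ ^ 2 = k.factorial * ‖f - g k‖ ^ 2 :=
    norm_sq_of_isMultipleIntegral hW ((symmKernel d k).sub_mem hf (hgs k)) (hfη.sub (hg k))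
  rw [h3] at h2
  have h4 : (1 : ℝ) ≤ k.factorial := by exact_mod_cast k.factorial_pos
  rw [dist_eq_norm]
  refine lt_of_pow_lt_pow_left₀ 2 hε.le (lt_of_le_of_lt ?_ h2)
  exact le_mul_of_one_le_left (sq_nonneg _) h4

end Measurability

/-! ### Products of kernels -/

section Product

variable {d i j n : ℕ}

/-- Splitting the `n = i + j` variables of a kernel into the first `i` and the last `j`. -/
def splitVars (hn : i + j = n) (x : Fin n → unitInterval × Fin d) :
    (Fin i → unitInterval × Fin d) × (Fin j → unitInterval × Fin d) :=
  (fun a => x (Fin.cast hn (Fin.castAdd j a)), fun b => x (Fin.cast hn (Fin.natAdd i b)))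

lemma measurePreserving_splitVars (hn : i + j = n) :
    MeasurePreserving (splitVars (d := d) hn) (kernelMeasure d n)
      ((kernelMeasure d i).prod (kernelMeasure d j)) := by
  subst hn
  have h1 := (measurePreserving_piCongrLeft (fun _ : Fin (i + j) => siteMeasure d)
    finSumFinEquiv).symm
  have h2 := measurePreserving_sumPiEquivProdPi fun _ : Fin i ⊕ Fin j => siteMeasure d
  convert! h2.comp h1 using 1

lemma memLp_mul_prod {α β : Type*} [MeasurableSpace α] [MeasurableSpace β] {μ : Measure α}
    {ν : Measure β} [SFinite μ] [SFinite ν] (f : Lp ℝ 2 μ) (g : Lp ℝ 2 ν) :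
    MemLp (fun p : α × β => f p.1 * g p.2) 2 (μ.prod ν) := by
  have hm : AEStronglyMeasurable (fun p : α × β => f p.1 * g p.2) (μ.prod ν) :=
    (Lp.aestronglyMeasurable f).comp_fst.mul (Lp.aestronglyMeasurable g).comp_snd
  rw [memLp_two_iff_integrable_sq hm]
  simp_rw [mul_pow]
  exact (Lp.memLp f).integrable_sq.mul_prod (Lp.memLp g).integrable_sq

lemma memLp_prodKernel (hn : i + j = n) (f : Kernel d i) (g : Kernel d j) :
    MemLp (fun x => f (splitVars hn x).1 * g (splitVars hn x).2) 2 (kernelMeasure d n) :=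
  (memLp_mul_prod f g).comp_measurePreserving (measurePreserving_splitVars hn)

/-- The tensor product of two kernels. -/
noncomputable def prodKernel (hn : i + j = n) (f : Kernel d i) (g : Kernel d j) : Kernel d n :=
  (memLp_prodKernel hn f g).toLp _

lemma coeFn_prodKernel (hn : i + j = n) (f : Kernel d i) (g : Kernel d j) :
    prodKernel hn f g =ᵐ[kernelMeasure d n]
      fun x => f (splitVars hn x).1 * g (splitVars hn x).2 :=
  (memLp_prodKernel hn f g).coeFn_toLp

lemma norm_prodKernel (hn : i + j = n) (f : Kernel d i) (g : Kernel d j) :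
    ‖prodKernel hn f g‖ = ‖f‖ * ‖g‖ := by
  have hsq : ∀ {m : ℕ} (f : Kernel d m), ‖f‖ ^ 2 = ∫ x, f x ^ 2 ∂kernelMeasure d m := by
    intro m f
    rw [← real_inner_self_eq_norm_sq, L2.inner_def]
    simp [sq]
  have h : ‖prodKernel hn f g‖ ^ 2 = (‖f‖ * ‖g‖) ^ 2 := by
    rw [mul_pow, hsq, hsq, hsq, ← integral_prod_mul, ← (measurePreserving_splitVars hn).map_eq,
      integral_map (measurePreserving_splitVars hn).measurable.aemeasurable]
    · refine integral_congr_ae ?_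
      filter_upwards [coeFn_prodKernel hn f g] with x hx
      rw [hx, mul_pow]
    · rw [(measurePreserving_splitVars hn).map_eq]
      exact ((Lp.memLp f).integrable_sq.mul_prod (Lp.memLp g).integrable_sq).1
  exact (sq_eq_sq₀ (norm_nonneg _) (by positivity)).1 h

lemma ae_splitVars_fst (hn : i + j = n) {p : (Fin i → unitInterval × Fin d) → Prop}
    (h : ∀ᵐ y ∂kernelMeasure d i, p y) : ∀ᵐ x ∂kernelMeasure d n, p (splitVars hn x).1 :=
  (measurePreserving_splitVars hn).quasiMeasurePreserving.ae
    (Measure.quasiMeasurePreserving_fst.ae h)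

lemma ae_splitVars_snd (hn : i + j = n) {p : (Fin j → unitInterval × Fin d) → Prop}
    (h : ∀ᵐ y ∂kernelMeasure d j, p y) : ∀ᵐ x ∂kernelMeasure d n, p (splitVars hn x).2 :=
  (measurePreserving_splitVars hn).quasiMeasurePreserving.ae
    (Measure.quasiMeasurePreserving_snd.ae h)

/-- The tensor product of kernels as a continuous bilinear map. -/
noncomputable def prodL (d : ℕ) (hn : i + j = n) : Kernel d i →L[ℝ] Kernel d j →L[ℝ] Kernel d n :=
  LinearMap.mkContinuous₂ (LinearMap.mk₂ ℝ (prodKernel hn)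
    (fun f f' g => by
      refine Lp.ext ?_
      filter_upwards [coeFn_prodKernel hn (f + f') g, coeFn_prodKernel hn f g,
        coeFn_prodKernel hn f' g, Lp.coeFn_add (prodKernel hn f g) (prodKernel hn f' g),
        ae_splitVars_fst hn (Lp.coeFn_add f f')] with x h1 h2 h3 h4 h5
      rw [h1, h4, h5, Pi.add_apply, Pi.add_apply, h2, h3, add_mul])
    (fun c f g => by
      refine Lp.ext ?_
      filter_upwards [coeFn_prodKernel hn (c • f) g, coeFn_prodKernel hn f g,
        Lp.coeFn_smul c (prodKernel hn f g),
        ae_splitVars_fst hn (Lp.coeFn_smul c f)] with x h1 h2 h3 h4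
      rw [h1, h3, h4, Pi.smul_apply, Pi.smul_apply, h2, smul_mul_assoc])
    (fun f g g' => by
      refine Lp.ext ?_
      filter_upwards [coeFn_prodKernel hn f (g + g'), coeFn_prodKernel hn f g,
        coeFn_prodKernel hn f g', Lp.coeFn_add (prodKernel hn f g) (prodKernel hn f g'),
        ae_splitVars_snd hn (Lp.coeFn_add g g')] with x h1 h2 h3 h4 h5
      rw [h1, h4, h5, Pi.add_apply, Pi.add_apply, h2, h3, mul_add])
    (fun c f g => by
      refine Lp.ext ?_
      filter_upwards [coeFn_prodKernel hn f (c • g), coeFn_prodKernel hn f g,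
        Lp.coeFn_smul c (prodKernel hn f g),
        ae_splitVars_snd hn (Lp.coeFn_smul c g)] with x h1 h2 h3 h4
      rw [h1, h3, h4, Pi.smul_apply, Pi.smul_apply, h2, mul_smul_comm])) 1
    (fun f g => by rw [one_mul]; exact (norm_prodKernel hn f g).le)

/-- The identification of `{1,…,i} ⊔ {1,…,j}` with `{1,…,n}`, where `n = i + j`. -/
def sumEquiv (hn : i + j = n) : Fin i ⊕ Fin j ≃ Fin n := finSumFinEquiv.trans (finCongr hn)

lemma prodKernel_tensor (hn : i + j = n) (u v : NoiseSpace d) :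
    prodKernel hn (tensor fun _ => u) (tensor fun _ => v) =
      tensor fun a => Sum.elim (fun _ => u) (fun _ => v) ((sumEquiv hn).symm a) := by
  refine Lp.ext ?_
  filter_upwards [coeFn_prodKernel hn (tensor fun _ => u) (tensor fun _ => v),
    ae_splitVars_fst hn (coeFn_tensor fun _ : Fin i => u),
    ae_splitVars_snd hn (coeFn_tensor fun _ : Fin j => v),
    coeFn_tensor fun a => Sum.elim (fun _ => u) (fun _ => v) ((sumEquiv hn).symm a)]
    with x h1 h2 h3 h4
  rw [h1, h2, h3, h4, ← (sumEquiv hn).prod_comp, Fintype.prod_sum_type]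
  simp only [Equiv.symm_apply_apply, Sum.elim_inl, Sum.elim_inr]
  rfl

/-- The symmetrised tensor product is the symmetrisation of the tensor product. -/
lemma ae_symmTensor (hn : i + j = n) (f : Kernel d i) (g : Kernel d j) :
    ∀ᵐ x ∂kernelMeasure d n, ((n.factorial : ℝ)⁻¹ • sumPerm d n (prodKernel hn f g)) x =
      symmTensor hn f g x := by
  have h1 : ∀ᵐ x ∂kernelMeasure d n, ∀ σ, permL σ (prodKernel hn f g) x =
      f (splitVars hn (x ∘ σ)).1 * g (splitVars hn (x ∘ σ)).2 := by
    refine ae_all_iff.2 fun σ => ?_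
    filter_upwards [coeFn_permL σ (prodKernel hn f g),
      (measurePreserving_perm d n σ).quasiMeasurePreserving.ae (coeFn_prodKernel hn f g)]
      with x h1 h2
    rw [h1, h2]
  filter_upwards [h1, Lp.coeFn_smul (n.factorial : ℝ)⁻¹ (sumPerm d n (prodKernel hn f g)),
    Lp.coeFn_fun_finsetSum Finset.univ fun σ => permL σ (prodKernel hn f g)] with x h1 h2 h3
  rw [h2, Pi.smul_apply, sumPerm_apply, h3, smul_eq_mul, symmTensor]
  congr 1
  exact Finset.sum_congr rfl fun σ _ => h1 σ

end Product

/-! ### Products of kernels over orthogonal subspaces -/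

/-- The permanent of a block diagonal matrix with constant blocks: only the permutations preserving
the two blocks contribute. -/
lemma sum_perm_sum_prod {α β : Type*} [Fintype α] [Fintype β] [DecidableEq α] [DecidableEq β]
    (M : α ⊕ β → α ⊕ β → ℝ) {x y : ℝ} (h₁ : ∀ a a', M (.inl a) (.inl a') = x)
    (h₂ : ∀ b b', M (.inr b) (.inr b') = y) (h₃ : ∀ a b, M (.inl a) (.inr b) = 0) :
    ∑ σ : Equiv.Perm (α ⊕ β), ∏ s, M s (σ s) =
      ((Fintype.card α).factorial * x ^ Fintype.card α) *
        ((Fintype.card β).factorial * y ^ Fintype.card β) := by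
  have h := Finset.sum_of_injOn (s := (Finset.univ : Finset (Equiv.Perm α × Equiv.Perm β)))
    (t := (Finset.univ : Finset (Equiv.Perm (α ⊕ β)))) (Equiv.Perm.sumCongrHom α β)
    (f := fun _ => x ^ Fintype.card α * y ^ Fintype.card β) (g := fun σ => ∏ s, M s (σ s))
    Equiv.Perm.sumCongrHom_injective.injOn (fun _ _ => by simp) ?_ ?_
  · rw [← h]
    simp [Fintype.card_perm, Fintype.card_prod]
    ring
  · intro σ _ hσ
    by_contra hne
    refine hσ ?_
    have hmaps : Set.MapsTo σ (Set.range Sum.inl) (Set.range Sum.inl) := by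
      rintro _ ⟨a, rfl⟩
      cases hs : σ (.inl a) with
      | inl b => exact ⟨b, rfl⟩
      | inr b =>
        refine absurd (Finset.prod_eq_zero (Finset.mem_univ (Sum.inl a)) ?_) hne
        rw [hs]
        exact h₃ a b
    obtain ⟨τ, hτ⟩ := Equiv.Perm.mem_sumCongrHom_range_of_perm_mapsTo_inl hmaps
    exact ⟨τ, by simp, hτ⟩
  · intro τ _
    simp [Fintype.prod_sum_type, h₁, h₂]

section Orthogonal

variable {d i j i' j' n : ℕ} {H₁ H₂ : Submodule ℝ (NoiseSpace d)}

/-- A bounded bilinear identity that holds for powers of elements of `H₁` and `H₂` holds on the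
symmetric powers. -/
lemma inner_prodKernel_of_tensor (hn : i + j = n) (Y : Kernel d n) (c : ℝ) (f₀ : Kernel d i)
    (g₀ : Kernel d j)
    (h : ∀ u ∈ H₁, ∀ v ∈ H₂, inner ℝ Y (prodKernel hn (tensor fun _ => u) (tensor fun _ => v)) =
      c * inner ℝ f₀ (tensor fun _ => u) * inner ℝ g₀ (tensor fun _ => v))
    {f : Kernel d i} (hf : f ∈ symmPower H₁ i) {g : Kernel d j} (hg : g ∈ symmPower H₂ j) :
    inner ℝ Y (prodKernel hn f g) = c * inner ℝ f₀ f * inner ℝ g₀ g := by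
  have h1 : ∀ u ∈ H₁, inner ℝ Y (prodKernel hn (tensor fun _ => u) g) =
      c * inner ℝ f₀ (tensor fun _ => u) * inner ℝ g₀ g := by
    intro u hu
    refine eq_of_mem_closure_span (L := (innerSL ℝ Y).comp (prodL d hn (tensor fun _ => u)))
      (M := (c * inner ℝ f₀ (tensor fun _ => u)) • innerSL ℝ g₀) ?_ hg
    rintro _ ⟨v, hv, rfl⟩
    exact h u hu v hv
  have h2 := eq_of_mem_closure_span (L := (innerSL ℝ Y).comp ((prodL d hn).flip g))
      (M := (c * inner ℝ g₀ g) • innerSL ℝ f₀) (fun _ hx => ?_) hf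
  · calc inner ℝ Y (prodKernel hn f g) = c * inner ℝ g₀ g * inner ℝ f₀ f := h2
      _ = _ := by ring
  · obtain ⟨u, hu, rfl⟩ := hx
    calc inner ℝ Y (prodKernel hn (tensor fun _ => u) g) = _ := h1 u hu
      _ = c * inner ℝ g₀ g * inner ℝ f₀ (tensor fun _ => u) := by ring

/-- The pairing of two products of powers, as the permanent of the matrix of the inner products of
their factors. -/
lemma inner_sumPerm_prodKernel_tensor (hn : i + j = n) (hn' : i' + j' = n)
    (u v u' v' : NoiseSpace d) :
    inner ℝ (sumPerm d n (prodKernel hn (tensor fun _ => u) (tensor fun _ => v)))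
      (prodKernel hn' (tensor fun _ => u') (tensor fun _ => v')) =
    ∑ σ : Equiv.Perm (Fin n), ∏ a,
      inner ℝ (Sum.elim (fun _ => u) (fun _ => v) ((sumEquiv hn).symm (σ a)) : NoiseSpace d)
        (Sum.elim (fun _ => u') (fun _ => v') ((sumEquiv hn').symm a)) := by
  rw [sumPerm_apply, sum_inner]
  simp_rw [prodKernel_tensor, permL_tensor, inner_tensor]
  exact Fintype.sum_equiv (Equiv.inv _) _ _ fun _ => rfl

/-- If `H₁ ⟂ H₂`, then the symmetrisations of the products of different bidegrees are orthogonal. -/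
lemma inner_sumPerm_prodKernel_of_ne (hH : H₁.IsOrtho H₂) (hn : i + j = n) (hn' : i' + j' = n)
    (hi : i ≠ i') {f : Kernel d i} (hf : f ∈ symmPower H₁ i) {g : Kernel d j}
    (hg : g ∈ symmPower H₂ j) {f' : Kernel d i'} (hf' : f' ∈ symmPower H₁ i') {g' : Kernel d j'}
    (hg' : g' ∈ symmPower H₂ j') :
    inner ℝ (sumPerm d n (prodKernel hn f g)) (prodKernel hn' f' g') = 0 := by
  have key : ∀ u ∈ H₁, ∀ v ∈ H₂, ∀ u' ∈ H₁, ∀ v' ∈ H₂,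
      inner ℝ (sumPerm d n (prodKernel hn (tensor fun _ => u) (tensor fun _ => v)))
        (prodKernel hn' (tensor fun _ => u') (tensor fun _ => v')) = 0 := by
    intro u hu v hv u' hu' v' hv'
    rw [inner_sumPerm_prodKernel_tensor]
    refine Finset.sum_eq_zero fun σ _ => ?_
    by_contra hne
    rw [← ne_eq, Finset.prod_ne_zero_iff] at hne
    -- A nonvanishing term matches the `i` variables of the first block with the `i'` ones.
    have h1 : ∀ a, ((sumEquiv hn).symm (σ a)).isLeft = ((sumEquiv hn').symm a).isLeft := by
      intro a
      have := hne a (Finset.mem_univ a)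
      revert this
      cases (sumEquiv hn).symm (σ a) <;> cases (sumEquiv hn').symm a <;>
        simp [hH.inner_eq hu hv', hH.symm.inner_eq hv hu']
    have count : ∀ {p q : ℕ} (h : p + q = n),
        ∑ a, (if ((sumEquiv h).symm a).isLeft then 1 else 0) = p := by
      intro p q h
      rw [← (sumEquiv h).sum_comp, Fintype.sum_sum_type]
      simp
    refine hi ?_
    rw [← count hn, ← count hn', ← Equiv.sum_comp σ]
    simp_rw [h1]
  -- The identity extends to the closed span in the first pair of kernels, then in the second.
  have h2 : ∀ u' ∈ H₁, ∀ v' ∈ H₂, inner ℝ (sumPerm d n (prodKernel hn f g))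
      (prodKernel hn' (tensor fun _ => u') (tensor fun _ => v')) = 0 := by
    intro u' hu' v' hv'
    rw [inner_sumPerm, real_inner_comm,
      inner_prodKernel_of_tensor hn _ 0 0 0 (fun u hu v hv => ?_) hf hg]
    · simp
    · rw [real_inner_comm, ← inner_sumPerm, key u hu v hv u' hu' v' hv']
      simp
  rw [inner_prodKernel_of_tensor hn' _ 0 0 0 (fun u hu v hv => ?_) hf' hg']
  · simp
  · rw [h2 u hu v hv]
    simp

/-- If `H₁ ⟂ H₂`, then the symmetrisations of products of the same bidegree satisfy an isometry
without contractions between the two groups of variables. -/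
lemma inner_sumPerm_prodKernel (hH : H₁.IsOrtho H₂) (hn : i + j = n)
    {f f' : Kernel d i} (hf : f ∈ symmPower H₁ i) (hf' : f' ∈ symmPower H₁ i)
    {g g' : Kernel d j} (hg : g ∈ symmPower H₂ j) (hg' : g' ∈ symmPower H₂ j) :
    inner ℝ (sumPerm d n (prodKernel hn f g)) (prodKernel hn f' g') =
      (i.factorial * j.factorial : ℝ) * inner ℝ f f' * inner ℝ g g' := by
  have key : ∀ u ∈ H₁, ∀ v ∈ H₂, ∀ u' ∈ H₁, ∀ v' ∈ H₂,
      inner ℝ (sumPerm d n (prodKernel hn (tensor fun _ => u) (tensor fun _ => v)))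
        (prodKernel hn (tensor fun _ => u') (tensor fun _ => v')) =
      (i.factorial * j.factorial : ℝ) * inner ℝ (tensor fun _ : Fin i => u) (tensor fun _ => u') *
        inner ℝ (tensor fun _ : Fin j => v) (tensor fun _ => v') := by
    intro u hu v hv u' hu' v' hv'
    rw [inner_sumPerm_prodKernel_tensor]
    have h := sum_perm_sum_prod (α := Fin i) (β := Fin j)
      (fun s t => inner ℝ (Sum.elim (fun _ => u) (fun _ => v) t : NoiseSpace d)
        (Sum.elim (fun _ => u') (fun _ => v') s)) (x := inner ℝ u u') (y := inner ℝ v v')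
      (fun _ _ => rfl) (fun _ _ => rfl) fun _ _ => hH.symm.inner_eq hv hu'
    rw [inner_tensor, inner_tensor]
    simp only [Finset.prod_const, Finset.card_univ, Fintype.card_fin] at h ⊢
    rw [mul_mul_mul_comm, ← mul_assoc] at h
    rw [← h]
    refine (Fintype.sum_equiv (sumEquiv hn).permCongr _ _ fun σ => ?_).symm
    rw [← (sumEquiv hn).prod_comp]
    simp [Equiv.permCongr_apply]
  have h2 : ∀ u' ∈ H₁, ∀ v' ∈ H₂, inner ℝ (sumPerm d n (prodKernel hn f g))
      (prodKernel hn (tensor fun _ => u') (tensor fun _ => v')) =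
      (i.factorial * j.factorial : ℝ) * inner ℝ f (tensor fun _ => u') *
        inner ℝ g (tensor fun _ => v') := by
    intro u' hu' v' hv'
    rw [inner_sumPerm, real_inner_comm,
      inner_prodKernel_of_tensor hn _ _ (tensor fun _ => u') (tensor fun _ => v')
        (fun u hu v hv => ?_) hf hg, real_inner_comm f, real_inner_comm g]
    rw [real_inner_comm, ← inner_sumPerm, key u hu v hv u' hu' v' hv',
      real_inner_comm (tensor fun _ => u'), real_inner_comm (tensor fun _ => v')]
  exact inner_prodKernel_of_tensor hn _ _ f g h2 hf' hg'

end Orthogonal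

/-! ### The Wick product -/

section Wick

variable {d : ℕ}

/-- The product `f_i ⊗ g_j`, for `i + j = n`, of two sequences of kernels. -/
noncomputable def prodTerm (f g : (k : ℕ) → Kernel d k) {n : ℕ}
    (p : Finset.HasAntidiagonal.antidiagonal n) : Kernel d n :=
  prodKernel (Finset.HasAntidiagonal.mem_antidiagonal.mp p.2) (f p.1.1) (g p.1.2)

/-- The kernel `∑_{i+j=n} f_i ⊗̂ g_j` of order `n` of a Wick product. -/
noncomputable def wickKernel (f g : (k : ℕ) → Kernel d k) (n : ℕ) : Kernel d n :=
  (n.factorial : ℝ)⁻¹ • sumPerm d n (∑ p, prodTerm f g p)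

lemma wickKernel_mem_symmKernel (f g : (k : ℕ) → Kernel d k) (n : ℕ) :
    wickKernel f g n ∈ symmKernel d n :=
  (symmKernel d n).smul_mem _ (sumPerm_mem_symmKernel _)

lemma coeFn_wickKernel (f g : (k : ℕ) → Kernel d k) (n : ℕ) :
    wickKernel f g n =ᵐ[kernelMeasure d n] fun x =>
      ∑ p : Finset.HasAntidiagonal.antidiagonal n,
        symmTensor (Finset.HasAntidiagonal.mem_antidiagonal.mp p.2) (f p.1.1) (g p.1.2) x := by
  rw [wickKernel, map_sum, Finset.smul_sum]
  filter_upwards [Lp.coeFn_fun_finsetSum Finset.univ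
      fun p => (n.factorial : ℝ)⁻¹ • sumPerm d n (prodTerm f g p),
    ae_all_iff.2 fun p : Finset.HasAntidiagonal.antidiagonal n =>
      ae_symmTensor (Finset.HasAntidiagonal.mem_antidiagonal.mp p.2) (f p.1.1) (g p.1.2)]
    with x h1 h2
  rw [h1]
  exact Finset.sum_congr rfl fun p _ => h2 p

/-- In the absence of contractions the squared norms of the terms of a Wick product are the
convolution of the squared norms of the factors. -/
lemma factorial_mul_norm_wickKernel_sq {H₁ H₂ : Submodule ℝ (NoiseSpace d)} (hH : H₁.IsOrtho H₂)
    {f g : (k : ℕ) → Kernel d k} (hf : ∀ k, f k ∈ symmPower H₁ k)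
    (hg : ∀ k, g k ∈ symmPower H₂ k) (n : ℕ) :
    n.factorial * ‖wickKernel f g n‖ ^ 2 = ∑ p ∈ Finset.HasAntidiagonal.antidiagonal n,
      (p.1.factorial * ‖f p.1‖ ^ 2) * (p.2.factorial * ‖g p.2‖ ^ 2) := by
  have h0 : (n.factorial : ℝ) ≠ 0 := by exact_mod_cast n.factorial_ne_zero
  have h1 : n.factorial * ‖wickKernel f g n‖ ^ 2 =
      inner ℝ (sumPerm d n (∑ p, prodTerm f g p)) (∑ p, prodTerm f g p) := by
    rw [← real_inner_self_eq_norm_sq]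
    nth_rw 2 [wickKernel]
    rw [inner_smul_right, ← mul_assoc, mul_inv_cancel₀ h0, one_mul, ← inner_sumPerm,
      sumPerm_of_mem (wickKernel_mem_symmKernel f g n), wickKernel, smul_smul, mul_inv_cancel₀ h0,
      one_smul]
  rw [h1, map_sum, sum_inner, ← Finset.sum_coe_sort (Finset.HasAntidiagonal.antidiagonal n)]
  refine Finset.sum_congr rfl fun p _ => ?_
  rw [inner_sum, Finset.sum_eq_single p]
  · rw [prodTerm, inner_sumPerm_prodKernel hH _ (hf _) (hf _) (hg _) (hg _),
      real_inner_self_eq_norm_sq, real_inner_self_eq_norm_sq]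
    ring
  · intro q _ hqp
    refine inner_sumPerm_prodKernel_of_ne hH _ _ (fun h => hqp ?_) (hf _) (hg _) (hf _) (hg _)
    exact Subtype.ext (Finset.HasAntidiagonal.antidiagonal_congr q.2 p.2 |>.2 h.symm)
  · simp

variable {Ω : Type*} [MeasurableSpace Ω] {P : Measure Ω} [IsProbabilityMeasure P]
  {w : unitInterval → Ω → EuclideanSpace ℝ (Fin d)} {W : NoiseSpace d →ₗᵢ[ℝ] Lp ℝ 2 P}

/-- Every two formal series have exactly one Wick product: it exists because all multiple integrals
do, and it is unique because the symmetric kernels of the factors are. -/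
lemma exists_wickProduct (hW : IsWienerMap w W) {η₁ η₂ : FormalSeries w P}
    {f g : (k : ℕ) → Kernel d k}
    (hf : ∀ k, f k ∈ symmKernel d k ∧ IsMultipleIntegral w P k (f k) (η₁ k))
    (hg : ∀ k, g k ∈ symmKernel d k ∧ IsMultipleIntegral w P k (g k) (η₂ k)) :
    ∃ ζ : FormalSeries w P, (∀ ζ', IsWickProduct w P η₁ η₂ ζ' ↔ ζ' = ζ) ∧
      ∀ n, IsMultipleIntegral w P n (wickKernel f g n) (ζ n) := by
  choose X hX using fun n => exists_isMultipleIntegral hW (wickKernel f g n)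
  let ζ : FormalSeries w P := fun n =>
    ⟨X n, (mem_chaos_iff w P n _).2 ⟨_, wickKernel_mem_symmKernel f g n, hX n⟩⟩
  refine ⟨ζ, fun ζ' => ⟨?_, ?_⟩, hX⟩
  · rintro ⟨f', g', h', hf', hg', hh'⟩
    obtain rfl : f' = f := funext fun k =>
      IsMultipleIntegral.kernel_unique hW (hf' k).1 (hf k).1 (hf' k).2 (hf k).2
    obtain rfl : g' = g := funext fun k =>
      IsMultipleIntegral.kernel_unique hW (hg' k).1 (hg k).1 (hg' k).2 (hg k).2
    funext n
    have hn : h' n = wickKernel f' g' n :=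
      Lp.ext ((hh' n).1.trans (coeFn_wickKernel f' g' n).symm)
    exact Subtype.ext (IsMultipleIntegral.unique hW (hn ▸ (hh' n).2) (hX n))
  · rintro rfl
    exact ⟨f, g, wickKernel f g, hf, hg, fun n => ⟨coeFn_wickKernel f g n, hX n⟩⟩

/-- Since `x ↦ x ^ γ` is decreasing for `γ < 0`, and `i` and `j` are at most `n`. -/
lemma weight_add_le {γ₁ γ₂ : ℝ} (h₁ : γ₁ < 0) (h₂ : γ₂ < 0) {i j n : ℕ} (hn : i + j = n) :
    ((n : ℝ) + 1) ^ (γ₁ + γ₂) ≤ ((i : ℝ) + 1) ^ γ₁ * ((j : ℝ) + 1) ^ γ₂ := by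
  have hi : (i : ℝ) + 1 ≤ n + 1 := by exact_mod_cast (by omega)
  have hj : (j : ℝ) + 1 ≤ n + 1 := by exact_mod_cast (by omega)
  rw [rpow_add (by positivity)]
  exact mul_le_mul (rpow_le_rpow_of_nonpos (by positivity) hi h₁.le)
    (rpow_le_rpow_of_nonpos (by positivity) hj h₂.le) (by positivity) (by positivity)

/-- A nonnegative sequence dominated by the convolution of two nonnegative summable sequences is
summable, with sum at most the product of the two sums. -/
lemma tsum_le_of_le_convolution {a b c : ℕ → ℝ} (ha : 0 ≤ a) (hb : 0 ≤ b) (hc : 0 ≤ c)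
    (hle : ∀ n, c n ≤ ∑ p ∈ Finset.HasAntidiagonal.antidiagonal n, a p.1 * b p.2)
    (sa : Summable a) (sb : Summable b) :
    Summable c ∧ ∑' n, c n ≤ (∑' n, a n) * ∑' n, b n := by
  have hs := sa.mul_of_nonneg sb ha hb
  have hsum := summable_sum_mul_antidiagonal_of_summable_mul hs
  have hmem : Summable c := hsum.of_nonneg_of_le hc hle
  refine ⟨hmem, ?_⟩
  rw [sa.tsum_mul_tsum_eq_tsum_sum_antidiagonal sb hs]
  exact hmem.tsum_le_tsum hle hsum

end Wick

end WickSobolev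

theorem mainTheorem7 {Ω : Type*} [MeasurableSpace Ω] (P : Measure Ω) [IsProbabilityMeasure P]
    {d : ℕ} (w : unitInterval → Ω → EuclideanSpace ℝ (Fin d))
    (hw : WickSobolev.IsBrownianMotion w P)
    (H₁ H₂ : Submodule ℝ (WickSobolev.NoiseSpace d)) (hH : H₁.IsOrtho H₂)
    (γ₁ γ₂ : ℝ) (hγ₁ : γ₁ < 0) (hγ₂ : γ₂ < 0)
    (η₁ η₂ : WickSobolev.FormalSeries w P)
    (hη₁ : η₁ ∈ WickSobolev.sobolevSpace w P γ₁)
    (hη₂ : η₂ ∈ WickSobolev.sobolevSpace w P γ₂)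
    (hm₁ : WickSobolev.IsMeasurableWrt (WickSobolev.noiseSigma w P H₁) w P γ₁ η₁)
    (hm₂ : WickSobolev.IsMeasurableWrt (WickSobolev.noiseSigma w P H₂) w P γ₂ η₂) :
    ∃ ζ : WickSobolev.FormalSeries w P,
      (∀ ζ' : WickSobolev.FormalSeries w P,
        WickSobolev.IsWickProduct w P η₁ η₂ ζ' ↔ ζ' = ζ) ∧
      ζ ∈ WickSobolev.sobolevSpace w P (γ₁ + γ₂) ∧
      WickSobolev.sobolevNorm w P (γ₁ + γ₂) ζ ≤
        WickSobolev.sobolevNorm w P γ₁ η₁ * WickSobolev.sobolevNorm w P γ₂ η₂ := by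
  obtain ⟨W, hiso, hiff⟩ := hw.exists_isIsonormal
  have hW : WickSobolev.IsWienerMap w W := ⟨hiso, hw, hiff⟩
  choose f hf using fun k => (WickSobolev.mem_chaos_iff w P k _).1 (η₁ k).2
  choose g hg using fun k => (WickSobolev.mem_chaos_iff w P k _).1 (η₂ k).2
  obtain ⟨ζ, hζ, hI⟩ := WickSobolev.exists_wickProduct hW hf hg
  have hf' := fun k =>
    WickSobolev.mem_symmPower_of_isMeasurableWrt hW hη₁ hm₁ (hf k).1 (hf k).2
  have hg' := fun k =>
    WickSobolev.mem_symmPower_of_isMeasurableWrt hW hη₂ hm₂ (hg k).1 (hg k).2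
  have hconv : ∀ n, ‖ζ n‖ ^ 2 =
      ∑ p ∈ Finset.HasAntidiagonal.antidiagonal n, ‖η₁ p.1‖ ^ 2 * ‖η₂ p.2‖ ^ 2 := by
    intro n
    have h1 := WickSobolev.norm_sq_of_isMultipleIntegral hW
      (WickSobolev.wickKernel_mem_symmKernel f g n) (hI n)
    rw [WickSobolev.factorial_mul_norm_wickKernel_sq hH hf' hg'] at h1
    refine h1.trans (Finset.sum_congr rfl fun p _ => ?_)
    rw [← WickSobolev.norm_sq_of_isMultipleIntegral hW (hf p.1).1 (hf p.1).2,
      ← WickSobolev.norm_sq_of_isMultipleIntegral hW (hg p.2).1 (hg p.2).2]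
    rfl
  obtain ⟨hs, hle⟩ := WickSobolev.tsum_le_of_le_convolution
    (a := fun k : ℕ => ((k : ℝ) + 1) ^ γ₁ * ‖η₁ k‖ ^ 2)
    (b := fun k : ℕ => ((k : ℝ) + 1) ^ γ₂ * ‖η₂ k‖ ^ 2)
    (c := fun k : ℕ => ((k : ℝ) + 1) ^ (γ₁ + γ₂) * ‖ζ k‖ ^ 2)
    (fun k => by positivity) (fun k => by positivity) (fun k => by positivity)
    (fun n => by
      rw [hconv, Finset.mul_sum]
      refine Finset.sum_le_sum fun p hp => ?_
      rw [mul_mul_mul_comm]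
      exact mul_le_mul_of_nonneg_right (WickSobolev.weight_add_le hγ₁ hγ₂
        (Finset.HasAntidiagonal.mem_antidiagonal.1 hp)) (by positivity)) hη₁ hη₂
  refine ⟨ζ, hζ, hs, ?_⟩
  have h0 : 0 ≤ ∑' k : ℕ, ((k : ℝ) + 1) ^ γ₁ * ‖η₁ k‖ ^ 2 := tsum_nonneg fun k => by positivity
  rw [WickSobolev.sobolevNorm, WickSobolev.sobolevNorm, WickSobolev.sobolevNorm,
    ← Real.sqrt_mul h0]
  exact Real.sqrt_le_sqrt hle
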